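/- Let $\mathfrak{k}$ be a finite dimensional Lie algebra over an arbitrary field $\Bbbk$, with universal enveloping algebra $U=U(\mathfrak{k})$. Let $S$ be a simple left $U$-module and $E$ a finite dimensional $U$-module, with dual $E^*=\mathrm{Hom}_{\Bbbk}(E,\Bbbk)$ on which $x\in\mathfrak{k}$ acts by $(xf)(e)=-f(xe)$. Let $T=S\otimes_{\Bbbk}E$, on which $x\in\mathfrak{k}$ acts by $x(s\otimes e)=xs\otimes e+s\otimes xe$. Conventions. For a $U$-module $M$, the socle $\mathrm{soc}(M)$ is the sum of all simple submodules of $M$ (zero if there are none), and the radical $\mathrm{rad}(M)$ is the intersection of all maximal submodules of $M$ (equal to $M$ if there are none). $M$ has *finite type socle* if $\mathrm{soc}(M)$ has finite length and is essential in $M$ (that is, $K\cap \mathrm{soc}(M)=0$ implies $K=0$ for every submodule $K\subset M$). $M$ has *finite type radical* if $M/\mathrm{rad}(M)$ has finite length and $\mathrm{rad}(M)$ is superfluous in $M$ (that is, $K+\mathrm{rad}(M)=M$ implies $K=M$ for every submodule $K\subset M$). Let $U_n\subset U$ be the span of all products of at most $n$ elements of $\mathfrak{k}$. For a non-zero finitely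 generated $U$-module $M$ with a finite dimensional generating subspace $M_0$, the Gelfand--Kirillov dimension $\mathsf{GK}(M)$ is the number $d\in\mathbb{N}$ such that, for some integers $a_0,\dots,a_d$ with $a_d\neq0$, one has $\dim_{\Bbbk}(U_nM_0)=\sum_{i=0}^d a_i\binom{n}{i}$ for all sufficiently large $n$; it does not depend on $M_0$. **Theorem.** The module $T=S\otimes E$ has finite type radical, and $\mathrm{soc}(T)$ has finite length. Furthermore, the following conditions are equivalent: (a) $T$ has finite type socle. (b) Every finitely generated left $U$-module $N$ for which there is a non-zero morphism $N\otimes E^*\to S$ has a simple subquotient $L$ for which there is a non-zero morphism $L\otimes E^*\to S$. (c) Every non-zero submodule of $T$ has a simple subquotient $L$ with $\mathsf{GK}(L)=\mathsf{GK}(S)$. -/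

import Mathlib

open scoped TensorProduct

universe u v w₁ w₂

noncomputable section

/-! ### Socles and radicals of modules over a ring -/

section Modules

variable (R : Type*) [Ring R] (M : Type*) [AddCommGroup M] [Module R M]

variable {R M} in
/-- `N` is an essential submodule of `M`. -/
def IsEssentialSubmodule (N : Submodule R M) : Prop :=
  ∀ K : Submodule R M, K ⊓ N = ⊥ → K = ⊥

variable {R M} in
/-- `N` is a superfluous submodule of `M`. -/
def IsSuperfluousSubmodule (N : Submodule R M) : Prop :=
  ∀ K : Submodule R M, K ⊔ N = ⊤ → K = ⊤

/-- The socle: the sum of all simple submodules (zero if there are none). -/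
def moduleSocle : Submodule R M :=
  sSup {N : Submodule R M | IsSimpleModule R N}

/-- The radical: the intersection of all maximal submodules (all of `M` if there are none). -/
def moduleRadical : Submodule R M :=
  sInf {N : Submodule R M | IsCoatom N}

/-- `M` has finite type socle. -/
def HasFiniteTypeSocle : Prop :=
  IsFiniteLength R (moduleSocle R M) ∧ IsEssentialSubmodule (moduleSocle R M)

/-- `M` has finite type radical. -/
def HasFiniteTypeRadical : Prop :=
  IsFiniteLength R (M ⧸ moduleRadical R M) ∧ IsSuperfluousSubmodule (moduleRadical R M)

variable {R M} in
/-- The subquotient `N₂ / N₁` of `M` (used for `N₁ ≤ N₂`). -/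
abbrev Subquotient (N₁ N₂ : Submodule R M) : Type _ :=
  N₂ ⧸ N₁.submoduleOf N₂

end Modules

/-! ### Modules over the universal enveloping algebra

A left module over `U = U(𝔤)` is given by `[Module U M]`; its underlying `k`-vector space
structure is the one restricted along `k → U`, which is what `[Module k M]` together with
`[IsScalarTower k U M]` says. -/

section Enveloping

variable (k : Type*) [Field k] (𝔤 : Type*) [LieRing 𝔤] [LieAlgebra k 𝔤]

section Constructions

attribute [local instance 100] LieRing.ofAssociativeRing

variable (M : Type*) [AddCommGroup M] [Module k M] [Module (UniversalEnvelopingAlgebra k 𝔤) M]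
  [IsScalarTower k (UniversalEnvelopingAlgebra k 𝔤) M]
variable (E : Type*) [AddCommGroup E] [Module k E] [Module (UniversalEnvelopingAlgebra k 𝔤) E]
  [IsScalarTower k (UniversalEnvelopingAlgebra k 𝔤) E]

/-- The action of `x ∈ 𝔤` on a `U(𝔤)`-module, as a `k`-linear endomorphism. -/
def lieAct (x : 𝔤) : M →ₗ[k] M :=
  Algebra.lsmul k k M (UniversalEnvelopingAlgebra.ι k x)

variable {𝔤 M} in
theorem lieAct_apply (x : 𝔤) (m : M) :
    lieAct k 𝔤 M x m = UniversalEnvelopingAlgebra.ι k x • m := rfl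

variable {𝔤} in
theorem lieAct_lie (x y : 𝔤) :
    lieAct k 𝔤 M ⁅x, y⁆ = lieAct k 𝔤 M x ∘ₗ lieAct k 𝔤 M y - lieAct k 𝔤 M y ∘ₗ lieAct k 𝔤 M x := by
  ext m
  simp [lieAct_apply, LieRing.of_associative_ring_bracket, sub_smul, mul_smul]

/-- The action of `𝔤` on `M ⊗ E`: `x (m ⊗ e) = x m ⊗ e + m ⊗ x e`. -/
def tensorLieHom : 𝔤 →ₗ⁅k⁆ Module.End k (M ⊗[k] E) where
  toFun x := (lieAct k 𝔤 M x).rTensor E + (lieAct k 𝔤 E x).lTensor M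
  map_add' x y := by
    ext m e
    simp [lieAct_apply, add_smul, TensorProduct.add_tmul, TensorProduct.tmul_add]
    abel
  map_smul' c x := by
    ext m e
    simp [lieAct_apply, TensorProduct.smul_tmul']
  map_lie' {x y} := by
    ext m e
    simp only [LinearMap.add_apply, LieRing.of_associative_ring_bracket, LinearMap.sub_apply,
      Module.End.mul_apply, TensorProduct.AlgebraTensorModule.curry_apply,
      LinearMap.restrictScalars_self, TensorProduct.curry_apply, LinearMap.rTensor_tmul,
      LinearMap.lTensor_tmul, lieAct_lie, LinearMap.comp_apply, map_add,
      TensorProduct.sub_tmul, TensorProduct.tmul_sub]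
    abel

/-- The action of `𝔤` on `E* = Hom_k(E, k)`: `(x f)(e) = - f (x e)`. -/
def dualLieHom : 𝔤 →ₗ⁅k⁆ Module.End k (Module.Dual k E) where
  toFun x := -(lieAct k 𝔤 E x).dualMap
  map_add' x y := by
    ext f e
    simp [lieAct_apply, add_smul]
    abel
  map_smul' c x := by
    ext f e
    simp [lieAct_apply]
  map_lie' {x y} := by
    ext f e
    simp [lieAct_lie, LieRing.of_associative_ring_bracket]

/-- The tensor product `M ⊗_k E` of two `U(𝔤)`-modules with its diagonal `U(𝔤)`-action.
(A type synonym: Mathlib lets `U(𝔤)` act on `M ⊗[k] E` through the left factor only.) -/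
def UTensor : Type _ := M ⊗[k] E

/-- The dual `E* = Hom_k(E, k)` of a `U(𝔤)`-module with its contragredient `U(𝔤)`-action. -/
def UDual : Type _ := Module.Dual k E

instance : AddCommGroup (UTensor k M E) := inferInstanceAs (AddCommGroup (M ⊗[k] E))
instance : Module k (UTensor k M E) := inferInstanceAs (Module k (M ⊗[k] E))
instance : AddCommGroup (UDual k E) := inferInstanceAs (AddCommGroup (Module.Dual k E))
instance : Module k (UDual k E) := inferInstanceAs (Module k (Module.Dual k E))

instance : Module (UniversalEnvelopingAlgebra k 𝔤) (UTensor k M E) :=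
  Module.compHom (M ⊗[k] E)
    (UniversalEnvelopingAlgebra.lift k (tensorLieHom k 𝔤 M E)).toRingHom

instance : Module (UniversalEnvelopingAlgebra k 𝔤) (UDual k E) :=
  Module.compHom (Module.Dual k E)
    (UniversalEnvelopingAlgebra.lift k (dualLieHom k 𝔤 E)).toRingHom

instance : IsScalarTower k (UniversalEnvelopingAlgebra k 𝔤) (UTensor k M E) where
  smul_assoc c u t := by
    change (UniversalEnvelopingAlgebra.lift k (tensorLieHom k 𝔤 M E) (c • u)) t =
      c • (UniversalEnvelopingAlgebra.lift k (tensorLieHom k 𝔤 M E) u) t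
    rw [map_smul]; rfl

instance : IsScalarTower k (UniversalEnvelopingAlgebra k 𝔤) (UDual k E) where
  smul_assoc c u t := by
    change (UniversalEnvelopingAlgebra.lift k (dualLieHom k 𝔤 E) (c • u)) t =
      c • (UniversalEnvelopingAlgebra.lift k (dualLieHom k 𝔤 E) u) t
    rw [map_smul]; rfl

/-- The identity map `M ⊗ E → UTensor k M E`. -/
def utensorEquiv : (M ⊗[k] E) ≃ₗ[k] UTensor k M E := LinearEquiv.refl k (M ⊗[k] E)

/-- The identity map `E* → UDual k E`. -/
def udualEquiv : Module.Dual k E ≃ₗ[k] UDual k E := LinearEquiv.refl k (Module.Dual k E)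

variable {𝔤 M E} in
theorem ι_smul_tmul (x : 𝔤) (m : M) (e : E) :
    UniversalEnvelopingAlgebra.ι k x • utensorEquiv k M E (m ⊗ₜ[k] e) =
      utensorEquiv k M E ((UniversalEnvelopingAlgebra.ι k x • m) ⊗ₜ[k] e +
        m ⊗ₜ[k] (UniversalEnvelopingAlgebra.ι k x • e)) := by
  change (UniversalEnvelopingAlgebra.lift k (tensorLieHom k 𝔤 M E)
    (UniversalEnvelopingAlgebra.ι k x)) (m ⊗ₜ[k] e) = _
  rw [UniversalEnvelopingAlgebra.lift_ι_apply]
  rfl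

variable {𝔤 E} in
theorem ι_smul_dual_apply (x : 𝔤) (f : UDual k E) (e : E) :
    (udualEquiv k E).symm (UniversalEnvelopingAlgebra.ι k x • f) e =
      - (udualEquiv k E).symm f (UniversalEnvelopingAlgebra.ι k x • e) := by
  change (UniversalEnvelopingAlgebra.lift k (dualLieHom k 𝔤 E)
    (UniversalEnvelopingAlgebra.ι k x)) f e = _
  rw [UniversalEnvelopingAlgebra.lift_ι_apply]
  rfl

end Constructions

/-! ### Gelfand-Kirillov dimension -/

/-- `U_n`: the span of all products of `n` or fewer elements of `𝔤`. -/
def envelopingFiltration (n : ℕ) : Submodule k (UniversalEnvelopingAlgebra k 𝔤) :=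
  Submodule.span k {u | ∃ l : List 𝔤, l.length ≤ n ∧
    u = (l.map (UniversalEnvelopingAlgebra.ι k)).prod}

variable {M : Type*} [AddCommGroup M] [Module k M] [Module (UniversalEnvelopingAlgebra k 𝔤) M]
  [IsScalarTower k (UniversalEnvelopingAlgebra k 𝔤) M]

/-- `M_n = U_n M_0`. -/
def moduleFiltration (M₀ : Submodule k M) (n : ℕ) : Submodule k M :=
  Submodule.span k {m | ∃ u ∈ envelopingFiltration k 𝔤 n, ∃ m₀ ∈ M₀, m = u • m₀}

variable (M) in
/-- `M` has Gelfand-Kirillov dimension `d`: for a finite dimensional generating subspace `M₀`, the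
function `n ↦ dim (U_n M₀)` agrees for all large `n` with `∑_{i ≤ d} a_i * binom(n, i)`, where the
`a_i` are integers and `a_d ≠ 0`. For `𝔤` finite dimensional and `M` finitely generated and
non-zero there is exactly one such `d`, and it does not depend on `M₀`. -/
def HasGKDim (d : ℕ) : Prop :=
  ∃ M₀ : Submodule k M, M₀.FG ∧
    Submodule.span (UniversalEnvelopingAlgebra k 𝔤) (M₀ : Set M) = ⊤ ∧
    ∃ (a : ℕ → ℤ) (n₀ : ℕ), a d ≠ 0 ∧ ∀ n : ℕ, n₀ ≤ n →
      (Module.finrank k (moduleFiltration k 𝔤 M₀ n) : ℤ) =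
        ∑ i ∈ Finset.range (d + 1), a i * (n.choose i : ℤ)

end Enveloping

end

/-! The proof compares Hilbert functions. For a finite dimensional subspace `V` of a module, `n ↦
dim (U_n V)` is studied for large `n`. If `M` has Gelfand-Kirillov dimension `d`, the coefficient
`a_d` is a positive integer, so the function grows at least like `n^d / (2 * d!)`. This bound does
not depend on `M`, and growth is superadditive on short exact sequences. Hence a module whose growth
is at most `C n^d` has room for only boundedly many layers with such a lower bound.

Tensoring with a finite dimensional module multiplies growth by at most its dimension
(`GrowthLE.utensor`, `GrowthGE.of_utensor`), so `T` grows at most like `C n^d` with `d = GK(S)`. The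
functors `- ⊗ E` and `- ⊗ E*` are adjoint on both sides (`InvariantPairing.exists_ne_zero_iff`). For
a maximal `K ⊂ T`, the quotient map transposes to an embedding of `S` into `(T/K) ⊗ E*`, so `T/K`
has growth bounded below uniformly in `K`. Therefore finitely many maximal submodules already cut
out the radical. Since `T` is finitely generated over the Noetherian ring `U`, its radical is
superfluous and its socle has finite length.

By adjunction, (b) is about modules with a non-zero map to `T`; a simple one has the
Gelfand-Kirillov dimension of `S`, which links (b) to (c). Given (c), a non-zero submodule without
simple submodules would contain arbitrarily many layers of dimension `d`, against the growth bound.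
So the socle is essential.

That Hilbert functions are polynomial and that `U` is Noetherian both follow from a Gröbner-type
argument: the leading exponents of a cyclic module form an upper set of `ℕ^r`, and Dickson's lemma
applies. -/

noncomputable section

/-! ### Upper sets of `ℕ^r` and eventually polynomial functions -/

section Combinatorics

open Filter Finset

/-- An ascending chain of upper sets of a well-quasi-order stabilizes. -/
theorem upperSet_chain_stabilizes {α : Type*} [Preorder α] [WellQuasiOrderedLE α]
    (I : ℕ → Set α) (hI : Monotone I) (hup : ∀ n, IsUpperSet (I n)) :
    ∃ n, ∀ m, n ≤ m → I m = I n := by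
  by_contra! H
  have H' : ∀ n, ∃ m x, n < m ∧ x ∈ I m ∧ x ∉ I n := by
    intro n
    obtain ⟨m, hm, hne⟩ := H n
    have hss : ¬ I m ⊆ I n := fun h => hne (h.antisymm (hI hm))
    obtain ⟨x, hx, hx'⟩ := Set.not_subset.1 hss
    exact ⟨m, x, lt_of_le_of_ne hm (by rintro rfl; exact hx' hx), hx, hx'⟩
  choose φ x hlt hx hx' using H'
  let s : ℕ → ℕ := fun j => φ^[j] 0
  have hs : ∀ j, s (j + 1) = φ (s j) := fun j => Function.iterate_succ_apply' φ j 0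
  have hsm : StrictMono s := strictMono_nat_of_lt_succ fun j => by rw [hs]; exact hlt _
  -- The point `x (s j)` is new in step `j`: it lies in `I (s (j + 1))` but not in `I (s j)`. A good
  -- pair `i < j` puts it into `I (s (i + 1)) ⊆ I (s j)`, a contradiction.
  obtain ⟨i, j, hij, hle⟩ := (wellQuasiOrdered_le (α := α)) (fun j => x (s j))
  refine hx' (s j) (hup _ hle (hI (hsm.monotone (Nat.succ_le_of_lt hij)) ?_))
  rw [hs]
  exact hx (s i)

/-- The `D`-th iterated difference of `f` vanishes eventually. -/
def EventuallyPoly : ℕ → (ℕ → ℤ) → Prop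
  | 0, f => ∀ᶠ n in atTop, f n = 0
  | D + 1, f => EventuallyPoly D fun n => f (n + 1) - f n

namespace EventuallyPoly

theorem succ {D : ℕ} : ∀ {f : ℕ → ℤ}, EventuallyPoly D f → EventuallyPoly (D + 1) f := by
  induction D with
  | zero =>
    intro f hf
    filter_upwards [hf, (tendsto_add_atTop_nat 1).eventually hf] with n h1 h2
    rw [h1, h2, sub_zero]
  | succ D ih => exact fun hf => ih hf

theorem mono {D D' : ℕ} (h : D ≤ D') {f : ℕ → ℤ} (hf : EventuallyPoly D f) :
    EventuallyPoly D' f := by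
  induction h with
  | refl => exact hf
  | step _ ih => exact ih.succ

theorem add {D : ℕ} : ∀ {f g : ℕ → ℤ}, EventuallyPoly D f → EventuallyPoly D g →
    EventuallyPoly D fun n => f n + g n := by
  induction D with
  | zero =>
    intro f g hf hg
    filter_upwards [hf, hg] with n h1 h2
    rw [h1, h2, add_zero]
  | succ D ih =>
    intro f g hf hg
    have := ih hf hg
    simp only [EventuallyPoly] at this ⊢
    convert this using 2
    ring

theorem shift_iff {D : ℕ} : ∀ {f : ℕ → ℤ},
    EventuallyPoly D (fun n => f (n + 1)) ↔ EventuallyPoly D f := by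
  induction D with
  | zero =>
    intro f
    refine ⟨fun h => ?_, fun h => (tendsto_add_atTop_nat 1).eventually h⟩
    obtain ⟨n₀, h⟩ := eventually_atTop.1 h
    refine eventually_atTop.2 ⟨n₀ + 1, fun n hn => ?_⟩
    obtain ⟨m, rfl⟩ := Nat.exists_eq_add_of_lt hn
    exact h (n₀ + m) (Nat.le_add_right _ _)
  | succ D ih => intro f; exact ih (f := fun n => f (n + 1) - f n)

theorem sum_range {D : ℕ} {f : ℕ → ℤ} (hf : EventuallyPoly D f) :
    EventuallyPoly (D + 1) fun n => ∑ m ∈ range (n + 1), f m := by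
  have := shift_iff.2 hf
  simp only [EventuallyPoly]
  convert this using 2 with n
  rw [Finset.sum_range_succ _ (n + 1)]
  ring

/-- This sums the contributions of the slices of a subset of `ℕ^(r+1)`. Once the slices are constant
the sum is a reflected cumulative sum, which costs one more difference; each earlier slice adds one
eventually polynomial term. -/
theorem convolution {g : ℕ → ℕ → ℤ} (hg : ∀ t, ∃ D, EventuallyPoly D (g t)) (t₀ : ℕ)
    (hst : ∀ t, t₀ ≤ t → g t = g t₀) :
    ∃ D, EventuallyPoly D fun n => ∑ t ∈ range (n + 1), g t (n - t) := by
  induction t₀ generalizing g with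
  | zero =>
    obtain ⟨D, hD⟩ := hg 0
    refine ⟨D + 1, ?_⟩
    convert hD.sum_range using 2 with n
    rw [← Finset.sum_range_reflect]
    refine Finset.sum_congr rfl fun t ht => ?_
    rw [hst _ (Nat.zero_le _)]
    congr 1
    simp only [Finset.mem_range] at ht
    omega
  | succ t₀ ih =>
    obtain ⟨D, hD⟩ := ih (g := fun t => g (t + 1)) (fun t => hg _) fun t ht => hst _ (by omega)
    obtain ⟨D', hD'⟩ := hg 0
    -- At `n + 1` the slice `t = 0` splits off and the others form the sum for `n` of the family
    -- shifted by one, with no truncated subtraction left.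
    refine ⟨max D D', shift_iff.1 ?_⟩
    convert (hD.mono (le_max_left D D')).add (shift_iff.2 (hD'.mono (le_max_right D D'))) using 2
      with n
    rw [Finset.sum_range_succ' _ (n + 1)]
    simp

/-- By Pascal's rule, raising each lower index by one turns the expansion of the difference into a
discrete antiderivative; it differs from `f` by an eventual constant, which becomes the coefficient
of `n.choose 0`. -/
theorem exists_binomial {D : ℕ} : ∀ {f : ℕ → ℤ}, EventuallyPoly D f →
    ∃ (a : ℕ → ℤ) (n₀ : ℕ), ∀ n, n₀ ≤ n → f n = ∑ i ∈ range D, a i * (n.choose i : ℤ) := by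
  induction D with
  | zero =>
    intro f hf
    obtain ⟨n₀, h⟩ := eventually_atTop.1 hf
    exact ⟨0, n₀, fun n hn => by simpa using h n hn⟩
  | succ D ih =>
    intro f hf
    obtain ⟨a, n₀, h⟩ := ih hf
    let g : ℕ → ℤ := fun n => ∑ i ∈ range D, a i * (n.choose (i + 1) : ℤ)
    have hconst : ∀ n, n₀ ≤ n → f n - g n = f n₀ - g n₀ := by
      intro n hn
      induction n, hn using Nat.le_induction with
      | base => rfl
      | succ n hn ih' =>
        have hg : g (n + 1) - g n = ∑ i ∈ range D, a i * (n.choose i : ℤ) := by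
          simp only [g, ← Finset.sum_sub_distrib]
          refine Finset.sum_congr rfl fun i _ => ?_
          rw [Nat.choose_succ_succ]
          push_cast
          ring
        linarith [h n hn]
    refine ⟨fun i => Nat.casesOn i (f n₀ - g n₀) a, n₀, fun n hn => ?_⟩
    rw [Finset.sum_range_succ']
    simp only [Nat.choose_zero_right, Nat.cast_one, mul_one]
    have := hconst n hn
    change f n = g n + (f n₀ - g n₀)
    linarith

end EventuallyPoly

theorem finite_sum_le (r n : ℕ) : {a : Fin r → ℕ | ∑ i, a i ≤ n}.Finite := by
  refine (Set.finite_Iic (fun _ : Fin r => n)).subset fun a ha i => ?_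
  exact (Finset.single_le_sum (fun _ _ => Nat.zero_le _) (Finset.mem_univ i)).trans ha

theorem ncard_compl_slice {r : ℕ} (I : Set (Fin (r + 1) → ℕ)) (n : ℕ) :
    {a | a ∉ I ∧ ∑ i, a i ≤ n}.ncard =
      ∑ t ∈ range (n + 1), {a : Fin r → ℕ | Fin.cons t a ∉ I ∧ ∑ i, a i ≤ n - t}.ncard := by
  classical
  have hfin : {a | a ∉ I ∧ ∑ i, a i ≤ n}.Finite := (finite_sum_le _ n).subset fun a ha => ha.2
  rw [Set.ncard_eq_toFinset_card _ hfin,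
    Finset.card_eq_sum_card_fiberwise (f := fun a => a 0) (t := range (n + 1))]
  · refine Finset.sum_congr rfl fun t ht => ?_
    have ht' : t ≤ n := by simpa [Nat.lt_succ_iff] using ht
    rw [← Set.ncard_coe_finset]
    symm
    refine Set.ncard_congr (fun a _ => Fin.cons t a) ?_ ?_ ?_
    · rintro a ⟨h1, h2⟩
      simp only [Finset.coe_filter, Set.Finite.mem_toFinset, Set.mem_ofPred_eq, Fin.cons_zero,
        and_true, Fin.sum_univ_succ, Fin.cons_succ]
      exact ⟨h1, by omega⟩
    · intro a b _ _ h
      exact (Fin.cons_inj.1 h).2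
    · intro b hb
      simp only [Finset.coe_filter, Set.Finite.mem_toFinset, Set.mem_ofPred_eq,
        Fin.sum_univ_succ] at hb
      obtain ⟨⟨h1, h2⟩, rfl⟩ := hb
      refine ⟨Fin.tail b, ⟨by rwa [Fin.cons_self_tail], ?_⟩, Fin.cons_self_tail b⟩
      simp only [Fin.tail]
      omega
  · intro a ha
    simp only [Set.Finite.coe_toFinset, Set.mem_ofPred_eq, Fin.sum_univ_succ] at ha
    simp only [Finset.coe_range, Set.mem_Iio]
    omega

/-- The number of points of degree at most `n` outside of an upper set of `ℕ^r` is eventually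
polynomial in `n`. -/
theorem eventuallyPoly_ncard_compl {r : ℕ} (I : Set (Fin r → ℕ)) (hI : IsUpperSet I) :
    ∃ D, EventuallyPoly D fun n => ({a | a ∉ I ∧ ∑ i, a i ≤ n}.ncard : ℤ) := by
  induction r with
  | zero =>
    refine ⟨1, ?_⟩
    simp [EventuallyPoly]
  | succ r ih =>
    let J : ℕ → Set (Fin r → ℕ) := fun t => {a | Fin.cons t a ∈ I}
    have hJup : ∀ t, IsUpperSet (J t) := fun t a b hab ha => hI (Fin.cons_le_cons.2 ⟨le_rfl, hab⟩) ha
    have hJmono : Monotone J := fun s t hst a ha => hI (Fin.cons_le_cons.2 ⟨hst, le_rfl⟩) ha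
    obtain ⟨t₀, ht₀⟩ := upperSet_chain_stabilizes J hJmono hJup
    obtain ⟨D, hD⟩ := EventuallyPoly.convolution
      (g := fun t n => ({a | a ∉ J t ∧ ∑ i, a i ≤ n}.ncard : ℤ)) (fun t => ih (J t) (hJup t)) t₀
      (fun t ht => by simp only [ht₀ t ht])
    refine ⟨D, ?_⟩
    convert hD using 2 with n
    rw [ncard_compl_slice]
    push_cast
    rfl

theorem exists_leading_binomial {D : ℕ} {f : ℕ → ℤ} {a : ℕ → ℤ} {n₀ : ℕ}
    (h : ∀ n, n₀ ≤ n → f n = ∑ i ∈ range D, a i * (n.choose i : ℤ)) (hf : ∀ n, f n ≠ 0) :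
    ∃ d, a d ≠ 0 ∧ ∀ n, n₀ ≤ n → f n = ∑ i ∈ range (d + 1), a i * (n.choose i : ℤ) := by
  induction D with
  | zero => exact absurd (by simpa using h n₀ le_rfl) (hf n₀)
  | succ D ih =>
    by_cases ha : a D = 0
    · refine ih fun n hn => ?_
      rw [h n hn, Finset.sum_range_succ, ha, zero_mul, add_zero]
    · exact ⟨D, ha, h⟩

open Topology in
theorem tendsto_choose_div_pow (i : ℕ) :
    Tendsto (fun n : ℕ => (n.choose i : ℝ) / (n : ℝ) ^ i) atTop (𝓝 (1 / (i.factorial : ℝ))) := by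
  have h := isEquivalent_choose i
  have h2 := (Asymptotics.isEquivalent_iff_tendsto_one ?_).1 h
  · have h3 := h2.div_const (i.factorial : ℝ)
    refine h3.congr' ?_
    filter_upwards [eventually_gt_atTop 0] with n hn
    have : (0 : ℝ) < i.factorial := by positivity
    simp only [Pi.div_apply]
    field_simp
  · filter_upwards [eventually_gt_atTop 0] with n hn
    positivity

open Topology in
theorem tendsto_binomial_sum_div_pow (a : ℕ → ℤ) (d : ℕ) :
    Tendsto (fun n : ℕ => (∑ i ∈ range (d + 1), (a i : ℝ) * (n.choose i : ℝ)) / (n : ℝ) ^ d) atTop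
      (𝓝 ((a d : ℝ) / d.factorial)) := by
  have hlow : ∀ i ∈ range d, Tendsto (fun n : ℕ => (a i : ℝ) * (n.choose i : ℝ) / (n : ℝ) ^ d)
      atTop (𝓝 0) := by
    intro i hi
    have hi' : i < d := Finset.mem_range.1 hi
    have h1 : Tendsto (fun n : ℕ => ((n : ℝ) ^ (d - i))⁻¹) atTop (𝓝 0) :=
      tendsto_inv_atTop_zero.comp
        ((tendsto_pow_atTop (by omega)).comp tendsto_natCast_atTop_atTop)
    have h2 := ((tendsto_choose_div_pow i).const_mul (a i : ℝ)).mul h1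
    rw [mul_zero] at h2
    refine h2.congr' ?_
    filter_upwards [eventually_gt_atTop 0] with n hn
    have hd : (n : ℝ) ^ d = (n : ℝ) ^ i * (n : ℝ) ^ (d - i) := by
      rw [← pow_add]
      congr 1
      omega
    have : (0 : ℝ) < n := by exact_mod_cast hn
    rw [hd]
    field_simp
  have h1 := tendsto_finsetSum _ hlow
  have h2 := h1.add ((tendsto_choose_div_pow d).const_mul (a d : ℝ))
  simp only [Finset.sum_const_zero, zero_add] at h2
  rw [mul_one_div] at h2
  refine h2.congr fun n => ?_
  rw [Finset.sum_range_succ, add_div, Finset.sum_div]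
  ring

/-- Two-sided bound for a function which is eventually a non-negative integral combination of
binomial coefficients; the lower constant depends on the degree only. -/
theorem binomial_growth {f : ℕ → ℕ} {a : ℕ → ℤ} {n₀ d : ℕ} (ha : a d ≠ 0)
    (h : ∀ n, n₀ ≤ n → (f n : ℤ) = ∑ i ∈ range (d + 1), a i * (n.choose i : ℤ)) :
    (∀ᶠ n : ℕ in atTop, 1 / (2 * d.factorial) * (n : ℝ) ^ d ≤ f n) ∧
      ∃ C : ℝ, ∀ᶠ n : ℕ in atTop, (f n : ℝ) ≤ C * (n : ℝ) ^ d := by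
  have ht := (tendsto_binomial_sum_div_pow a d).congr' (f₂ := fun n => (f n : ℝ) / (n : ℝ) ^ d) (by
    filter_upwards [eventually_ge_atTop n₀] with n hn
    have : (f n : ℝ) = ((f n : ℤ) : ℝ) := by simp
    rw [this, h n hn]
    push_cast
    rfl)
  have hfac : (0 : ℝ) < d.factorial := by positivity
  have hnn : 0 ≤ (a d : ℝ) / d.factorial :=
    ge_of_tendsto' ht fun n => by positivity
  -- Integrality enters here: the limit is non-negative and `a d` is a non-zero integer. The lower
  -- constant is half of `1 / d!`, to have a strict inequality in the limit.
  have had : (1 : ℝ) ≤ a d := by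
    have h0 : 0 ≤ a d := by
      by_contra hneg
      push Not at hneg
      have : (a d : ℝ) / d.factorial < 0 := div_neg_of_neg_of_pos (by exact_mod_cast hneg) hfac
      linarith
    exact_mod_cast (lt_of_le_of_ne h0 (Ne.symm ha))
  have hlt : 1 / (2 * (d.factorial : ℝ)) < (a d : ℝ) / d.factorial := by
    rw [div_lt_div_iff₀ (by positivity) hfac]
    nlinarith
  constructor
  · filter_upwards [ht.eventually (lt_mem_nhds hlt), eventually_gt_atTop 0] with n hn hn0
    have : (0 : ℝ) < (n : ℝ) ^ d := by positivity
    exact ((lt_div_iff₀ this).1 hn).le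
  · refine ⟨(a d : ℝ) / d.factorial + 1, ?_⟩
    filter_upwards [ht.eventually (gt_mem_nhds (lt_add_one _)), eventually_gt_atTop 0] with n hn hn0
    have : (0 : ℝ) < (n : ℝ) ^ d := by positivity
    exact ((div_lt_iff₀ this).1 hn).le

end Combinatorics

/-! ### Standard indices of an ordered family of vectors -/

section StandardIndices

variable {K : Type*} [Field K] {V : Type*} [AddCommGroup V] [Module K V]
  {I : Type*} [LinearOrder I]

variable (K) in
/-- The indices of those members of a family that are not combinations of previous ones. -/
def standardIndices (v : I → V) : Set I :=
  {i | v i ∉ Submodule.span K (v '' Set.Iio i)}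

/-- In a non-trivial relation, the member with the largest index that occurs would be a combination
of previous ones. -/
theorem linearIndepOn_standardIndices (v : I → V) : LinearIndepOn K v (standardIndices K v) := by
  classical
  rw [LinearIndepOn, linearIndependent_iff']
  intro s g hsum
  by_contra! hne
  obtain ⟨i₀, hi₀, hg₀⟩ := hne
  have hfne : (s.filter fun i : standardIndices K v => g i ≠ 0).Nonempty := ⟨i₀, Finset.mem_filter.2 ⟨hi₀, hg₀⟩⟩
  obtain ⟨i, hi, hmax⟩ := Finset.exists_max_image _ (fun i : standardIndices K v => (i : I)) hfne
  obtain ⟨his, hgi⟩ := Finset.mem_filter.1 hi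
  apply i.2
  rw [← Finset.add_sum_erase _ _ his] at hsum
  have hv : v i = -(g i)⁻¹ • ∑ j ∈ s.erase i, g j • v j := by
    rw [eq_neg_of_add_eq_zero_right hsum, smul_neg, neg_smul, neg_neg, smul_smul,
      inv_mul_cancel₀ hgi, one_smul]
  rw [hv]
  refine Submodule.smul_mem _ _ (Submodule.sum_mem _ fun j hj => ?_)
  obtain ⟨hji, hjs⟩ := Finset.mem_erase.1 hj
  by_cases hgj : g j = 0
  · rw [hgj, zero_smul]
    exact Submodule.zero_mem _
  · refine Submodule.smul_mem _ _ (Submodule.subset_span ⟨j, ?_, rfl⟩)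
    exact lt_of_le_of_ne (hmax j (Finset.mem_filter.2 ⟨hjs, hgj⟩)) fun h => hji (Subtype.ext h)

theorem span_image_inter_standardIndices [WellFoundedLT I] (v : I → V) {D : Set I}
    (hD : IsLowerSet D) :
    Submodule.span K (v '' (D ∩ standardIndices K v)) = Submodule.span K (v '' D) := by
  refine le_antisymm (Submodule.span_mono (Set.image_mono Set.inter_subset_left)) ?_
  rw [Submodule.span_le]
  rintro _ ⟨i, hi, rfl⟩
  induction i using WellFoundedLT.induction with
  | ind i ih =>
    by_cases hs : i ∈ standardIndices K v
    · exact Submodule.subset_span ⟨i, ⟨hi, hs⟩, rfl⟩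
    · have hmem : v i ∈ Submodule.span K (v '' Set.Iio i) := not_not.1 hs
      refine (Submodule.span_le.2 ?_) hmem
      rintro _ ⟨j, hj, rfl⟩
      exact ih j hj (hD (le_of_lt hj) hi)

theorem finrank_span_image_lowerSet [WellFoundedLT I] (v : I → V) {D : Set I}
    (hD : IsLowerSet D) (hfin : D.Finite) :
    Module.finrank K (Submodule.span K (v '' D)) = (D ∩ standardIndices K v).ncard := by
  rw [← span_image_inter_standardIndices v hD]
  have hli := (linearIndepOn_standardIndices (K := K) v).mono
    (Set.inter_subset_right (s := D))
  have : Fintype (D ∩ standardIndices K v : Set I) := (hfin.inter_of_left _).fintype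
  rw [Set.image_eq_range, finrank_span_eq_card hli, Set.ncard_eq_toFinset_card', Set.toFinset_card]

end StandardIndices

/-! ### The filtration of the enveloping algebra and its monomials -/

section Filtration

open UniversalEnvelopingAlgebra

theorem smul_mem_of_mem_span {K A M : Type*} [CommSemiring K] [Semiring A] [Algebra K A]
    [AddCommMonoid M] [Module K M] [Module A M] [IsScalarTower K A M] {s : Set A} {m : M}
    {P : Submodule K M} (h : ∀ u ∈ s, u • m ∈ P) {u : A} (hu : u ∈ Submodule.span K s) :
    u • m ∈ P :=
  (Submodule.span_le (p := P.comap ((LinearMap.toSpanSingleton A M m).restrictScalars K))).2 h hu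

theorem smul_mem_of_mem_span_right {K A M : Type*} [CommSemiring K] [Semiring A] [Algebra K A]
    [AddCommMonoid M] [Module K M] [Module A M] [IsScalarTower K A M] {s : Set M} {u : A}
    {P : Submodule K M} (h : ∀ m ∈ s, u • m ∈ P) {m : M} (hm : m ∈ Submodule.span K s) :
    u • m ∈ P :=
  (Submodule.span_le (p := P.comap (Algebra.lsmul K K M u))).2 h hm

variable {k : Type*} [Field k] {𝔤 : Type*} [LieRing 𝔤] [LieAlgebra k 𝔤]

attribute [local instance 100] LieRing.ofAssociativeRing in
theorem ι_lie (x y : 𝔤) : ι k ⁅x, y⁆ = ι k x * ι k y - ι k y * ι k x := LieHom.map_lie _ _ _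

theorem list_prod_mem_envelopingFiltration {l : List 𝔤} {n : ℕ} (h : l.length ≤ n) :
    (l.map (ι k)).prod ∈ envelopingFiltration k 𝔤 n :=
  Submodule.subset_span ⟨l, h, rfl⟩

theorem one_mem_envelopingFiltration (n : ℕ) : 1 ∈ envelopingFiltration k 𝔤 n :=
  list_prod_mem_envelopingFiltration (l := []) (Nat.zero_le _)

theorem ι_mem_envelopingFiltration (x : 𝔤) : ι k x ∈ envelopingFiltration k 𝔤 1 := by
  simpa using list_prod_mem_envelopingFiltration (k := k) (l := [x]) le_rfl

theorem envelopingFiltration_mono : Monotone (envelopingFiltration k 𝔤) := by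
  intro m n h
  refine Submodule.span_mono ?_
  rintro _ ⟨l, hl, rfl⟩
  exact ⟨l, hl.trans h, rfl⟩

theorem mul_mem_envelopingFiltration {m n : ℕ} {u v : UniversalEnvelopingAlgebra k 𝔤}
    (hu : u ∈ envelopingFiltration k 𝔤 m) (hv : v ∈ envelopingFiltration k 𝔤 n) :
    u * v ∈ envelopingFiltration k 𝔤 (m + n) := by
  have h : envelopingFiltration k 𝔤 m * envelopingFiltration k 𝔤 n ≤
      envelopingFiltration k 𝔤 (m + n) := by
    rw [envelopingFiltration, envelopingFiltration, Submodule.span_mul_span, Submodule.span_le]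
    rintro _ ⟨_, ⟨l, hl, rfl⟩, _, ⟨l', hl', rfl⟩, rfl⟩
    refine Submodule.subset_span ⟨l ++ l', ?_, by simp⟩
    rw [List.length_append]
    omega
  exact h (Submodule.mul_mem_mul hu hv)

attribute [local instance 100] LieRing.ofAssociativeRing in
/-- Induction principle: a subalgebra that contains the image of `𝔤` is everything. -/
theorem mem_subalgebra_of_ι_mem (A : Subalgebra k (UniversalEnvelopingAlgebra k 𝔤))
    (h : ∀ x, ι k x ∈ A) (u : UniversalEnvelopingAlgebra k 𝔤) : u ∈ A := by
  let f : 𝔤 →ₗ⁅k⁆ A :=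
    { toFun := fun x => ⟨ι k x, h x⟩
      map_add' := fun x y => Subtype.ext (map_add (ι k) x y)
      map_smul' := fun c x => Subtype.ext (map_smul (ι k) c x)
      map_lie' := fun {x y} => Subtype.ext (ι_lie x y) }
  have : A.val.comp (lift k f) = AlgHom.id k _ := by
    ext x
    simp [f]
  rw [← AlgHom.id_apply (R := k) u, ← this]
  exact (lift k f u).2

theorem exists_mem_envelopingFiltration (u : UniversalEnvelopingAlgebra k 𝔤) :
    ∃ n, u ∈ envelopingFiltration k 𝔤 n := by
  let A : Subalgebra k (UniversalEnvelopingAlgebra k 𝔤) :=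
    { carrier := {u | ∃ n, u ∈ envelopingFiltration k 𝔤 n}
      mul_mem' := fun ⟨m, hm⟩ ⟨n, hn⟩ => ⟨m + n, mul_mem_envelopingFiltration hm hn⟩
      add_mem' := fun ⟨m, hm⟩ ⟨n, hn⟩ => ⟨max m n, Submodule.add_mem _
        (envelopingFiltration_mono (le_max_left _ _) hm)
        (envelopingFiltration_mono (le_max_right _ _) hn)⟩
      algebraMap_mem' := fun c => ⟨0, by
        rw [Algebra.algebraMap_eq_smul_one]
        exact Submodule.smul_mem _ _ (one_mem_envelopingFiltration 0)⟩ }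
  exact mem_subalgebra_of_ι_mem A (fun x => ⟨1, ι_mem_envelopingFiltration x⟩) u

variable (k 𝔤) in
/-- The span of all products of less than `n` elements of `𝔤`. -/
def lowerFiltration : ℕ → Submodule k (UniversalEnvelopingAlgebra k 𝔤)
  | 0 => ⊥
  | n + 1 => envelopingFiltration k 𝔤 n

theorem mul_mem_lowerFiltration {m n : ℕ} {u v : UniversalEnvelopingAlgebra k 𝔤}
    (hu : u ∈ envelopingFiltration k 𝔤 m) (hv : v ∈ lowerFiltration k 𝔤 n) :
    u * v ∈ lowerFiltration k 𝔤 (m + n) := by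
  cases n with
  | zero =>
    rw [(Submodule.mem_bot k).1 hv, mul_zero]
    exact Submodule.zero_mem _
  | succ n => exact mul_mem_envelopingFiltration hu hv

/-- Modulo products with fewer factors, the factors of a product commute. -/
theorem list_prod_sub_mem_of_perm {l l' : List 𝔤} (h : l.Perm l') :
    (l.map (ι k)).prod - (l'.map (ι k)).prod ∈ lowerFiltration k 𝔤 l.length := by
  induction h with
  | nil => simp
  | @cons x l l' _ ih =>
    simp only [List.map_cons, List.prod_cons, List.length_cons, ← mul_sub]
    rw [add_comm]
    exact mul_mem_lowerFiltration (ι_mem_envelopingFiltration x) ih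
  | swap x y l =>
    simp only [List.map_cons, List.prod_cons, List.length_cons, ← mul_assoc, ← sub_mul]
    rw [← ι_lie, add_comm l.length 1]
    exact mul_mem_envelopingFiltration (ι_mem_envelopingFiltration _)
      (list_prod_mem_envelopingFiltration le_rfl)
  | trans h₁ _ ih₁ ih₂ =>
    rw [h₁.length_eq] at ih₁ ⊢
    simpa using Submodule.add_mem _ ih₁ ih₂

variable {r : ℕ} (b : Module.Basis (Fin r) k 𝔤)

/-- A product of basis elements with prescribed multiplicities, in some order. -/
def basisMonomial (a : Fin r →₀ ℕ) : UniversalEnvelopingAlgebra k 𝔤 :=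
  (((Finsupp.toMultiset a).toList.map b).map (ι k)).prod

theorem length_toMultiset_toList (a : Fin r →₀ ℕ) :
    (Finsupp.toMultiset a).toList.length = a.degree := by
  rw [Multiset.length_toList, Finsupp.card_toMultiset]
  rfl

theorem basisMonomial_mem (a : Fin r →₀ ℕ) :
    basisMonomial b a ∈ envelopingFiltration k 𝔤 a.degree :=
  list_prod_mem_envelopingFiltration (by rw [List.length_map, length_toMultiset_toList])

theorem basisMonomial_zero : basisMonomial b 0 = 1 := by
  simp [basisMonomial]

theorem basisMonomial_mul_sub_mem (a c : Fin r →₀ ℕ) :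
    basisMonomial b a * basisMonomial b c - basisMonomial b (a + c) ∈
      lowerFiltration k 𝔤 (a + c).degree := by
  have hp : ((Finsupp.toMultiset a).toList ++ (Finsupp.toMultiset c).toList).Perm
      (Finsupp.toMultiset (a + c)).toList := by
    rw [← Multiset.coe_eq_coe, ← Multiset.coe_add, Multiset.coe_toList, Multiset.coe_toList,
      Multiset.coe_toList, map_add]
  have := list_prod_sub_mem_of_perm (k := k) (hp.map b)
  rw [List.length_map, hp.length_eq, length_toMultiset_toList] at this
  simpa [basisMonomial] using this

theorem ι_basis_eq_basisMonomial (i : Fin r) :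
    ι k (b i) = basisMonomial b (Finsupp.single i 1) := by
  simp [basisMonomial, Finsupp.toMultiset_single]

/-- This is the spanning half of the Poincaré-Birkhoff-Witt theorem, which is all that is needed:
reordering a product costs only terms with fewer factors. -/
theorem envelopingFiltration_eq_span (n : ℕ) :
    envelopingFiltration k 𝔤 n =
      Submodule.span k (basisMonomial b '' {a | a.degree ≤ n}) := by
  apply le_antisymm
  · induction n with
    | zero =>
      refine Submodule.span_le.2 ?_
      rintro _ ⟨l, hl, rfl⟩
      rw [List.length_eq_zero_iff.1 (Nat.le_zero.1 hl)]
      exact Submodule.subset_span ⟨0, by simp, by simp [basisMonomial_zero]⟩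
    | succ n ih =>
      have hmono : Submodule.span k (basisMonomial b '' {a | a.degree ≤ n}) ≤
          Submodule.span k (basisMonomial b '' {a | a.degree ≤ n + 1}) :=
        Submodule.span_mono (Set.image_mono fun a (ha : a.degree ≤ n) => Nat.le_succ_of_le ha)
      refine Submodule.span_le.2 ?_
      rintro _ ⟨l, hl, rfl⟩
      cases l with
      | nil => exact Submodule.subset_span ⟨0, by simp, by simp [basisMonomial_zero]⟩
      | cons y l =>
        have hl' : l.length ≤ n := by simpa using hl
        have hu := ih (list_prod_mem_envelopingFiltration hl')
        rw [List.map_cons, List.prod_cons]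
        generalize (l.map (ι k)).prod = u at hu
        induction hu using Submodule.span_induction with
        | zero => simp
        | add u v _ _ hu hv =>
          rw [mul_add]
          exact Submodule.add_mem _ hu hv
        | smul c u _ hu =>
          rw [mul_smul_comm]
          exact Submodule.smul_mem _ _ hu
        | mem u hu =>
          obtain ⟨a, ha, rfl⟩ := hu
          rw [← b.sum_repr y, map_sum, Finset.sum_mul]
          refine Submodule.sum_mem _ fun i _ => ?_
          rw [map_smul, smul_mul_assoc]
          refine Submodule.smul_mem _ _ ?_
          rw [ι_basis_eq_basisMonomial, ← sub_add_cancel (basisMonomial b _ * _)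
            (basisMonomial b (Finsupp.single i 1 + a))]
          have hdeg : (Finsupp.single i 1 + a).degree = a.degree + 1 := by
            rw [map_add, Finsupp.degree_single, add_comm]
          refine Submodule.add_mem _ (hmono (ih ?_)) (Submodule.subset_span ⟨_, ?_, rfl⟩)
          · have := basisMonomial_mul_sub_mem b (Finsupp.single i 1) a
            rw [hdeg] at this
            exact envelopingFiltration_mono ha this
          · change (Finsupp.single i 1 + a).degree ≤ n + 1
            rw [hdeg]
            exact Nat.succ_le_succ ha
  · refine Submodule.span_le.2 ?_
    rintro _ ⟨a, ha, rfl⟩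
    exact envelopingFiltration_mono ha (basisMonomial_mem b a)

theorem finite_degree_le (n : ℕ) : {a : Fin r →₀ ℕ | a.degree ≤ n}.Finite := by
  refine Set.Finite.of_finite_image (f := fun a => (a : Fin r → ℕ))
    ((finite_sum_le r n).subset ?_) DFunLike.coe_injective.injOn
  rintro _ ⟨a, ha, rfl⟩
  simpa [Finsupp.degree_eq_sum] using ha

end Filtration

/-! ### Leading exponents of cyclic modules, Hilbert functions, Noetherianity -/

section StandardMonomials

open UniversalEnvelopingAlgebra

variable {k : Type*} [Field k] {𝔤 : Type*} [LieRing 𝔤] [LieAlgebra k 𝔤]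
  {r : ℕ} (b : Module.Basis (Fin r) k 𝔤)
  {M : Type*} [AddCommGroup M] [Module k M] [Module (UniversalEnvelopingAlgebra k 𝔤) M]
  [IsScalarTower k (UniversalEnvelopingAlgebra k 𝔤) M]

/-- The family of all monomials in a basis of `𝔤`, applied to a vector. -/
def monomialFamily (m : M) (a : DegLex (Fin r →₀ ℕ)) : M :=
  basisMonomial b (ofDegLex a) • m

theorem lowerFiltration_smul_mem (m : M) {u : UniversalEnvelopingAlgebra k 𝔤}
    {a : DegLex (Fin r →₀ ℕ)} (hu : u ∈ lowerFiltration k 𝔤 (ofDegLex a).degree) :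
    u • m ∈ Submodule.span k (monomialFamily b m '' Set.Iio a) := by
  match h : (ofDegLex a).degree, hu with
  | 0, hu =>
    rw [(Submodule.mem_bot k).1 hu, zero_smul]
    exact Submodule.zero_mem _
  | n + 1, hu =>
    replace hu : u ∈ envelopingFiltration k 𝔤 n := hu
    rw [envelopingFiltration_eq_span b] at hu
    refine smul_mem_of_mem_span ?_ hu
    rintro _ ⟨c, hc, rfl⟩
    refine Submodule.subset_span ⟨toDegLex c, ?_, rfl⟩
    refine Finsupp.DegLex.lt_iff.2 (Or.inl ?_)
    rw [h]
    exact Nat.lt_succ_of_le hc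

/-- The exponents of the monomials that are combinations of previous monomials on `m`. -/
def leadingExponents (m : M) : Set (Fin r →₀ ℕ) :=
  {a | toDegLex a ∉ standardIndices k (monomialFamily b m)}

/-- A relation that expresses the monomial of `a` on `m` by smaller ones can be multiplied by the
monomial of `c`. Products of monomials are monomials up to lower degree, and the order compares
degrees first and is compatible with addition, so all errors stay below `a + c`. -/
theorem isUpperSet_leadingExponents (m : M) : IsUpperSet (leadingExponents b m) := by
  intro a a' haa' ha
  obtain ⟨c, rfl⟩ := exists_add_of_le haa'
  have ha : basisMonomial b a • m ∈
    Submodule.span k (monomialFamily b m '' Set.Iio (toDegLex a)) := not_not.1 ha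
  refine not_not.2 ?_
  change basisMonomial b (a + c) • m ∈ _
  have key : ∀ d, toDegLex d ≤ toDegLex (a + c) → ∀ e, c + e = d →
      (basisMonomial b c * basisMonomial b e - basisMonomial b d) • m ∈
        Submodule.span k (monomialFamily b m '' Set.Iio (toDegLex (a + c))) := by
    rintro d hd e rfl
    refine Submodule.span_mono (Set.image_mono (Set.Iio_subset_Iio hd))
      (lowerFiltration_smul_mem b m (basisMonomial_mul_sub_mem b c e))
  have h1 : (basisMonomial b c * basisMonomial b a) • m ∈
      Submodule.span k (monomialFamily b m '' Set.Iio (toDegLex (a + c))) := by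
    rw [mul_smul]
    refine smul_mem_of_mem_span_right ?_ ha
    rintro _ ⟨e, he, rfl⟩
    have he : e < toDegLex a := he
    have hlt : toDegLex (c + ofDegLex e) < toDegLex (a + c) := by
      rw [add_comm a c, toDegLex_add, toDegLex_add]
      exact add_lt_add_right he _
    have := key _ hlt.le _ rfl
    rw [sub_smul, mul_smul] at this
    rw [← sub_add_cancel (basisMonomial b c • monomialFamily b m e)
      (basisMonomial b (c + ofDegLex e) • m)]
    exact Submodule.add_mem _ this (Submodule.subset_span ⟨_, hlt, rfl⟩)
  have h2 := key _ le_rfl a (add_comm c a)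
  rw [sub_smul] at h2
  simpa using Submodule.sub_mem _ h1 h2

theorem moduleFiltration_span_singleton (m : M) (n : ℕ) :
    moduleFiltration k 𝔤 (Submodule.span k {m}) n =
      Submodule.span k (monomialFamily b m '' {a : DegLex (Fin r →₀ ℕ) | (ofDegLex a).degree ≤ n}) := by
  apply le_antisymm
  · refine Submodule.span_le.2 ?_
    rintro _ ⟨u, hu, _, hm, rfl⟩
    obtain ⟨c, rfl⟩ := Submodule.mem_span_singleton.1 hm
    rw [smul_algebra_smul_comm]
    refine Submodule.smul_mem _ _ ?_
    rw [envelopingFiltration_eq_span b] at hu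
    refine smul_mem_of_mem_span ?_ hu
    rintro _ ⟨c, hc, rfl⟩
    exact Submodule.subset_span ⟨toDegLex c, hc, rfl⟩
  · refine Submodule.span_mono ?_
    rintro _ ⟨a, ha, rfl⟩
    exact ⟨_, envelopingFiltration_mono ha (basisMonomial_mem b _), m,
      Submodule.mem_span_singleton_self m, rfl⟩

theorem isLowerSet_degree_le (n : ℕ) :
    IsLowerSet {a : DegLex (Fin r →₀ ℕ) | (ofDegLex a).degree ≤ n} :=
  fun _ _ h ha => (Finsupp.DegLex.monotone_degree h).trans ha

theorem finrank_moduleFiltration_span_singleton (m : M) (n : ℕ) :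
    Module.finrank k (moduleFiltration k 𝔤 (Submodule.span k {m}) n) =
      {a : Fin r → ℕ | a ∉ DFunLike.coe '' leadingExponents b m ∧ ∑ i, a i ≤ n}.ncard := by
  rw [moduleFiltration_span_singleton b,
    finrank_span_image_lowerSet _ (isLowerSet_degree_le n) (finite_degree_le n)]
  refine Set.ncard_congr (fun (a : DegLex (Fin r →₀ ℕ)) _ => ⇑(ofDegLex a)) ?_ ?_ ?_
  · rintro a ⟨h1, h2⟩
    refine ⟨?_, by simpa [Finsupp.degree_eq_sum] using h1⟩
    rintro ⟨c, hc, hca⟩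
    exact hc (by rwa [DFunLike.coe_injective hca])
  · intro a a' _ _ h
    exact ofDegLex_injective (DFunLike.coe_injective h)
  · rintro a ⟨h1, h2⟩
    refine ⟨toDegLex (Finsupp.equivFunOnFinite.symm a), ⟨?_, ?_⟩, rfl⟩
    · simpa [Finsupp.degree_eq_sum] using h2
    · by_contra h
      exact h1 ⟨_, h, rfl⟩

theorem eventuallyPoly_finrank_moduleFiltration [FiniteDimensional k 𝔤] (m : M) :
    ∃ D, EventuallyPoly D fun n =>
      (Module.finrank k (moduleFiltration k 𝔤 (Submodule.span k {m}) n) : ℤ) := by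
  let b := Module.finBasis k 𝔤
  obtain ⟨D, hD⟩ := eventuallyPoly_ncard_compl (DFunLike.coe '' leadingExponents b m) (by
    rintro _ c hac ⟨a, ha, rfl⟩
    exact ⟨Finsupp.equivFunOnFinite.symm c, isUpperSet_leadingExponents b m hac ha, rfl⟩)
  refine ⟨D, ?_⟩
  convert hD using 3 with n
  exact finrank_moduleFiltration_span_singleton b m n

/-- A cyclic module has a Gelfand-Kirillov dimension. -/
theorem exists_hasGKDim_of_span_singleton [FiniteDimensional k 𝔤] [Nontrivial M] {m : M}
    (hm : Submodule.span (UniversalEnvelopingAlgebra k 𝔤) {m} = ⊤) : ∃ d, HasGKDim k 𝔤 M d := by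
  obtain ⟨D, hD⟩ := eventuallyPoly_finrank_moduleFiltration (k := k) (𝔤 := 𝔤) m
  obtain ⟨a, n₀, h⟩ := hD.exists_binomial
  have hm0 : m ≠ 0 := by
    rintro rfl
    rw [Submodule.span_zero_singleton] at hm
    exact bot_ne_top hm
  have hne : ∀ n, (Module.finrank k
      (moduleFiltration k 𝔤 (Submodule.span k {m}) n) : ℤ) ≠ 0 := by
    intro n h0
    -- Needed because `finrank` is also zero on infinite dimensional spaces.
    have hfin : FiniteDimensional k (moduleFiltration k 𝔤 (Submodule.span k {m}) n) := by
      rw [moduleFiltration_span_singleton (Module.finBasis k 𝔤)]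
      exact FiniteDimensional.span_of_finite k ((finite_degree_le n).image _)
    have hbot := Submodule.finrank_eq_zero.1 (Int.natCast_eq_zero.1 h0)
    refine hm0 ((Submodule.mem_bot k).1 (hbot ▸ Submodule.subset_span ⟨1,
      one_mem_envelopingFiltration n, m, Submodule.mem_span_singleton_self m, (one_smul _ m).symm⟩))
  obtain ⟨d, had, hd⟩ := exists_leading_binomial h hne
  exact ⟨d, Submodule.span k {m}, Submodule.fg_span_singleton m, by
    rw [Submodule.span_span_of_tower, hm], a, n₀, had, hd⟩

theorem leadingExponents_subset_map {M' : Type*} [AddCommGroup M'] [Module k M']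
    [Module (UniversalEnvelopingAlgebra k 𝔤) M']
    [IsScalarTower k (UniversalEnvelopingAlgebra k 𝔤) M']
    (f : M →ₗ[UniversalEnvelopingAlgebra k 𝔤] M') (m : M) :
    leadingExponents b m ⊆ leadingExponents b (f m) := by
  intro a ha
  refine not_not.2 ?_
  have := Submodule.mem_map_of_mem (f := f.restrictScalars k) (not_not.1 ha)
  rw [Submodule.map_span, ← Set.image_comp] at this
  have hf : ∀ a, f (monomialFamily b m a) = monomialFamily b (f m) a := fun a => map_smul f _ m
  simpa only [Function.comp_def, LinearMap.coe_restrictScalars, hf] using this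

/-- The standard monomials on `m` span `M`. If the exponents agree, they are mapped to the standard
monomials on `f m`, which are linearly independent. -/
theorem injective_of_leadingExponents_eq {M' : Type*} [AddCommGroup M'] [Module k M']
    [Module (UniversalEnvelopingAlgebra k 𝔤) M']
    [IsScalarTower k (UniversalEnvelopingAlgebra k 𝔤) M']
    (f : M →ₗ[UniversalEnvelopingAlgebra k 𝔤] M') {m : M}
    (hm : Submodule.span (UniversalEnvelopingAlgebra k 𝔤) {m} = ⊤)
    (h : leadingExponents b (f m) = leadingExponents b m) : Function.Injective f := by
  rw [injective_iff_map_eq_zero]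
  intro x hx
  have hstd : standardIndices k (monomialFamily b (f m)) =
      standardIndices k (monomialFamily b m) := by
    ext a
    exact not_iff_not.1 (Set.ext_iff.1 h (ofDegLex a))
  have hli := linearIndepOn_standardIndices (K := k) (monomialFamily b (f m))
  rw [hstd, LinearIndepOn] at hli
  have hf : ∀ a, f (monomialFamily b m a) = monomialFamily b (f m) a := fun a => map_smul f _ m
  simp only [← hf] at hli
  have hmem : x ∈ Submodule.span k (monomialFamily b m ''
      standardIndices k (monomialFamily b m)) := by
    have h1 := span_image_inter_standardIndices (K := k) (monomialFamily b m) isLowerSet_univ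
    rw [Set.univ_inter] at h1
    rw [h1]
    obtain ⟨u, rfl⟩ := Submodule.mem_span_singleton.1 (hm ▸ Submodule.mem_top : x ∈ _)
    obtain ⟨n, hn⟩ := exists_mem_envelopingFiltration u
    rw [envelopingFiltration_eq_span b] at hn
    refine smul_mem_of_mem_span ?_ hn
    rintro _ ⟨c, -, rfl⟩
    exact Submodule.subset_span ⟨toDegLex c, trivial, rfl⟩
  rw [Set.image_eq_range] at hmem
  have hdisj := Submodule.range_ker_disjoint (f := f.restrictScalars k)
    (v := fun a : standardIndices k (monomialFamily b m) => monomialFamily b m a) hli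
  exact Submodule.disjoint_def.1 hdisj _ hmem hx

variable (k 𝔤) in
-- A chain of left ideals `F i` gives quotients `U / F i` generated by the class of `1`, with
-- increasing sets of leading exponents. When these sets stabilize, the transition maps are
-- injective, so the chain is stationary.
theorem isNoetherianRing_universalEnvelopingAlgebra [FiniteDimensional k 𝔤] :
    IsNoetherianRing (UniversalEnvelopingAlgebra k 𝔤) := by
  let b := Module.finBasis k 𝔤
  refine monotone_stabilizes_iff_noetherian.1 fun F => ?_
  have hF : ∀ i j (hij : i ≤ j), Submodule.factor (F.monotone hij) ((F i).mkQ 1) =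
    (F j).mkQ 1 := fun _ _ _ => rfl
  have hmono : Monotone fun i => leadingExponents b ((F i).mkQ 1) := by
    intro i j hij
    change leadingExponents b ((F i).mkQ 1) ⊆ leadingExponents b ((F j).mkQ 1)
    rw [← hF i j hij]
    exact leadingExponents_subset_map b _ _
  obtain ⟨n, hn⟩ := upperSet_chain_stabilizes _ hmono fun i => isUpperSet_leadingExponents b _
  refine ⟨n, fun m hm => le_antisymm (F.monotone hm) fun u hu => ?_⟩
  have hgen : Submodule.span (UniversalEnvelopingAlgebra k 𝔤) {(F n).mkQ 1} = ⊤ := by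
    rw [← Set.image_singleton, ← Submodule.map_span, Ideal.submodule_span_eq,
      Ideal.span_singleton_one, Submodule.map_top, Submodule.range_mkQ]
  have hinj := injective_of_leadingExponents_eq b (Submodule.factor (F.monotone hm)) hgen
    (by rw [hF n m hm]; exact hn m hm)
  refine (Submodule.Quotient.mk_eq_zero (F n)).1 (hinj ?_)
  rw [map_zero]
  exact (Submodule.Quotient.mk_eq_zero (F m)).2 hu

end StandardMonomials

/-! ### Growth bounds for arbitrary modules -/

section Growth

set_option linter.unusedSectionVars false

open UniversalEnvelopingAlgebra Filter

variable {k : Type*} [Field k] {𝔤 : Type*} [LieRing 𝔤] [LieAlgebra k 𝔤]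
  {M : Type*} [AddCommGroup M] [Module k M] [Module (UniversalEnvelopingAlgebra k 𝔤) M]
  [IsScalarTower k (UniversalEnvelopingAlgebra k 𝔤) M]
  {M' : Type*} [AddCommGroup M'] [Module k M'] [Module (UniversalEnvelopingAlgebra k 𝔤) M']
  [IsScalarTower k (UniversalEnvelopingAlgebra k 𝔤) M']
  {M'' : Type*} [AddCommGroup M''] [Module k M''] [Module (UniversalEnvelopingAlgebra k 𝔤) M'']
  [IsScalarTower k (UniversalEnvelopingAlgebra k 𝔤) M'']

theorem moduleFiltration_eq_map₂ (V : Submodule k M) (n : ℕ) :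
    moduleFiltration k 𝔤 V n =
      Submodule.map₂ (Algebra.lsmul k k M).toLinearMap (envelopingFiltration k 𝔤 n) V := by
  rw [Submodule.map₂_eq_span_image2, moduleFiltration]
  congr 1
  ext m
  constructor
  · rintro ⟨u, hu, v, hv, rfl⟩
    exact ⟨u, hu, v, hv, rfl⟩
  · rintro ⟨u, hu, v, hv, rfl⟩
    exact ⟨u, hu, v, hv, rfl⟩

theorem smul_mem_moduleFiltration {V : Submodule k M} {n : ℕ}
    {u : UniversalEnvelopingAlgebra k 𝔤} (hu : u ∈ envelopingFiltration k 𝔤 n) {v : M}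
    (hv : v ∈ V) : u • v ∈ moduleFiltration k 𝔤 V n :=
  Submodule.subset_span ⟨u, hu, v, hv, rfl⟩

theorem fg_moduleFiltration [FiniteDimensional k 𝔤] {V : Submodule k M} (hV : V.FG) (n : ℕ) :
    (moduleFiltration k 𝔤 V n).FG := by
  rw [moduleFiltration_eq_map₂]
  refine Submodule.FG.map₂ _ ?_ hV
  rw [envelopingFiltration_eq_span (Module.finBasis k 𝔤)]
  exact Submodule.fg_span ((finite_degree_le n).image _)

theorem moduleFiltration_mono {V W : Submodule k M} (h : V ≤ W) (n : ℕ) :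
    moduleFiltration k 𝔤 V n ≤ moduleFiltration k 𝔤 W n := by
  refine Submodule.span_mono ?_
  rintro _ ⟨u, hu, v, hv, rfl⟩
  exact ⟨u, hu, v, h hv, rfl⟩

theorem moduleFiltration_mono_right (V : Submodule k M) :
    Monotone (moduleFiltration k 𝔤 V) := by
  intro m n h
  refine Submodule.span_mono ?_
  rintro _ ⟨u, hu, v, hv, rfl⟩
  exact ⟨u, envelopingFiltration_mono h hu, v, hv, rfl⟩

theorem map_moduleFiltration (f : M →ₗ[UniversalEnvelopingAlgebra k 𝔤] M') (V : Submodule k M)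
    (n : ℕ) : (moduleFiltration k 𝔤 V n).map (f.restrictScalars k) =
      moduleFiltration k 𝔤 (V.map (f.restrictScalars k)) n := by
  rw [moduleFiltration, moduleFiltration, Submodule.map_span]
  congr 1
  ext m
  constructor
  · rintro ⟨_, ⟨u, hu, v, hv, rfl⟩, rfl⟩
    exact ⟨u, hu, f v, ⟨v, hv, rfl⟩, map_smul f u v⟩
  · rintro ⟨u, hu, _, ⟨v, hv, rfl⟩, rfl⟩
    exact ⟨_, ⟨u, hu, v, hv, rfl⟩, map_smul f u v⟩

theorem smul_mem_moduleFiltration_add {W : Submodule k M} {m n : ℕ}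
    {u : UniversalEnvelopingAlgebra k 𝔤} (hu : u ∈ envelopingFiltration k 𝔤 n) {v : M}
    (hv : v ∈ moduleFiltration k 𝔤 W m) : u • v ∈ moduleFiltration k 𝔤 W (n + m) := by
  refine smul_mem_of_mem_span_right ?_ hv
  rintro _ ⟨u', hu', w, hw, rfl⟩
  rw [← mul_smul]
  exact smul_mem_moduleFiltration (mul_mem_envelopingFiltration hu hu') hw

theorem moduleFiltration_le_add {V W : Submodule k M} {c : ℕ}
    (h : V ≤ moduleFiltration k 𝔤 W c) (n : ℕ) :
    moduleFiltration k 𝔤 V n ≤ moduleFiltration k 𝔤 W (n + c) := by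
  refine Submodule.span_le.2 ?_
  rintro _ ⟨u, hu, v, hv, rfl⟩
  exact smul_mem_moduleFiltration_add hu (h hv)

theorem exists_mem_moduleFiltration {W : Submodule k M}
    (hW : Submodule.span (UniversalEnvelopingAlgebra k 𝔤) (W : Set M) = ⊤) (v : M) :
    ∃ c, v ∈ moduleFiltration k 𝔤 W c := by
  have hv : v ∈ Submodule.span (UniversalEnvelopingAlgebra k 𝔤) (W : Set M) := hW ▸ trivial
  induction hv using Submodule.span_induction with
  | zero => exact ⟨0, Submodule.zero_mem _⟩
  | add x y _ _ hx hy =>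
    obtain ⟨m, hm⟩ := hx
    obtain ⟨n, hn⟩ := hy
    exact ⟨max m n, Submodule.add_mem _ (moduleFiltration_mono_right W (le_max_left m n) hm)
      (moduleFiltration_mono_right W (le_max_right m n) hn)⟩
  | smul u x _ hx =>
    obtain ⟨m, hm⟩ := hx
    obtain ⟨n, hn⟩ := exists_mem_envelopingFiltration u
    exact ⟨n + m, smul_mem_moduleFiltration_add hn hm⟩
  | mem x hx =>
    exact ⟨0, by simpa using smul_mem_moduleFiltration (one_mem_envelopingFiltration 0) hx⟩

theorem exists_le_moduleFiltration {V W : Submodule k M} (hV : V.FG)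
    (hW : Submodule.span (UniversalEnvelopingAlgebra k 𝔤) (W : Set M) = ⊤) :
    ∃ c, V ≤ moduleFiltration k 𝔤 W c := by
  induction V, hV using Submodule.fg_induction with
  | singleton x =>
    obtain ⟨c, hc⟩ := exists_mem_moduleFiltration hW x
    exact ⟨c, (Submodule.span_singleton_le_iff_mem _ _).2 hc⟩
  | sup V₁ V₂ _ _ h₁ h₂ =>
    obtain ⟨m, hm⟩ := h₁
    obtain ⟨n, hn⟩ := h₂
    exact ⟨max m n, sup_le (hm.trans (moduleFiltration_mono_right W (le_max_left m n)))
      (hn.trans (moduleFiltration_mono_right W (le_max_right m n)))⟩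

theorem exists_fg_map_eq {f : M →ₗ[k] M'} (hf : Function.Surjective f) {V : Submodule k M'}
    (hV : V.FG) : ∃ W : Submodule k M, W.FG ∧ W.map f = V := by
  obtain ⟨s, hs, rfl⟩ := Submodule.fg_def.1 hV
  refine ⟨Submodule.span k (Function.surjInv hf '' s), Submodule.fg_span (hs.image _), ?_⟩
  rw [Submodule.map_span, ← Set.image_comp, Function.RightInverse.comp_eq_id
    (Function.rightInverse_surjInv hf), Set.image_id]

variable (k 𝔤 M)

/-- Some finite dimensional subspace `V` of `M` satisfies `dim (U_n V) ≥ c n ^ d` for large `n`. -/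
def GrowthGE (c : ℝ) (d : ℕ) : Prop :=
  ∃ V : Submodule k M, V.FG ∧
    ∀ᶠ n : ℕ in atTop, c * (n : ℝ) ^ d ≤ Module.finrank k (moduleFiltration k 𝔤 V n)

/-- All finite dimensional subspaces `V` of `M` satisfy `dim (U_n V) ≤ c n ^ d` for large `n`. -/
def GrowthLE (c : ℝ) (d : ℕ) : Prop :=
  ∀ V : Submodule k M, V.FG →
    ∀ᶠ n : ℕ in atTop, (Module.finrank k (moduleFiltration k 𝔤 V n) : ℝ) ≤ c * (n : ℝ) ^ d

variable {k 𝔤 M} {c c' : ℝ} {d d' : ℕ}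

theorem GrowthGE.of_injective (f : M →ₗ[UniversalEnvelopingAlgebra k 𝔤] M')
    (hf : Function.Injective f) (h : GrowthGE k 𝔤 M c d) : GrowthGE k 𝔤 M' c d := by
  obtain ⟨V, hV, h⟩ := h
  refine ⟨V.map (f.restrictScalars k), hV.map _, h.mono fun n hn => ?_⟩
  rw [← map_moduleFiltration]
  exact hn.trans_eq (congrArg _
    (Submodule.equivMapOfInjective (f.restrictScalars k) hf _).finrank_eq)

theorem GrowthGE.of_surjective [FiniteDimensional k 𝔤]
    (f : M →ₗ[UniversalEnvelopingAlgebra k 𝔤] M') (hf : Function.Surjective f)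
    (h : GrowthGE k 𝔤 M' c d) : GrowthGE k 𝔤 M c d := by
  obtain ⟨V, hV, h⟩ := h
  obtain ⟨W, hW, rfl⟩ := exists_fg_map_eq (f := f.restrictScalars k) hf hV
  refine ⟨W, hW, h.mono fun n hn => hn.trans ?_⟩
  rw [← map_moduleFiltration]
  have := Module.Finite.iff_fg.2 (fg_moduleFiltration (𝔤 := 𝔤) hW n)
  exact_mod_cast Submodule.finrank_map_le _ _

theorem GrowthLE.of_injective (f : M →ₗ[UniversalEnvelopingAlgebra k 𝔤] M')
    (hf : Function.Injective f) (h : GrowthLE k 𝔤 M' c d) : GrowthLE k 𝔤 M c d := by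
  intro V hV
  refine (h _ (hV.map (f.restrictScalars k))).mono fun n hn => ?_
  rw [← map_moduleFiltration] at hn
  exact (congrArg _ (Submodule.equivMapOfInjective (f.restrictScalars k) hf _).finrank_eq).trans_le
    hn

/-- Growth is superadditive on short exact sequences. -/
theorem GrowthGE.add [FiniteDimensional k 𝔤]
    {f : M →ₗ[UniversalEnvelopingAlgebra k 𝔤] M'} (hf : Function.Injective f)
    {g : M' →ₗ[UniversalEnvelopingAlgebra k 𝔤] M''} (hg : Function.Surjective g)
    (hfg : ∀ x, g (f x) = 0)
    (h : GrowthGE k 𝔤 M c d) (h' : GrowthGE k 𝔤 M'' c' d) : GrowthGE k 𝔤 M' (c + c') d := by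
  obtain ⟨V₁, hV₁, h⟩ := h
  obtain ⟨V₂, hV₂, h'⟩ := h'
  obtain ⟨V₂, hV₂', rfl⟩ := exists_fg_map_eq (f := g.restrictScalars k) hg hV₂
  refine ⟨V₁.map (f.restrictScalars k) ⊔ V₂, (hV₁.map _).sup hV₂', ?_⟩
  filter_upwards [h, h'] with n h1 h2
  set W := moduleFiltration k 𝔤 (V₁.map (f.restrictScalars k) ⊔ V₂) n with hW
  have : Module.Finite k W := Module.Finite.iff_fg.2 (fg_moduleFiltration ((hV₁.map _).sup hV₂') n)
  have hA : (moduleFiltration k 𝔤 V₁ n).map (f.restrictScalars k) ≤ W := by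
    rw [map_moduleFiltration]
    exact moduleFiltration_mono le_sup_left n
  have hB : moduleFiltration k 𝔤 (V₂.map (g.restrictScalars k)) n ≤
      W.map (g.restrictScalars k) := by
    rw [← map_moduleFiltration]
    exact Submodule.map_mono (moduleFiltration_mono le_sup_right n)
  -- Rank-nullity for `g` on `W`: the image contains `U_n g(V₂)` and the kernel contains a copy of
  -- `U_n V₁`.
  have hrank := LinearMap.finrank_range_add_finrank_ker ((g.restrictScalars k).domRestrict W)
  rw [LinearMap.range_domRestrict] at hrank
  have h3 := Submodule.finrank_mono hB
  have h4 : Module.finrank k (moduleFiltration k 𝔤 V₁ n) ≤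
      Module.finrank k (LinearMap.ker ((g.restrictScalars k).domRestrict W)) := by
    rw [(Submodule.equivMapOfInjective (f.restrictScalars k) hf _).finrank_eq,
      ← (Submodule.comapSubtypeEquivOfLe hA).finrank_eq]
    refine Submodule.finrank_mono ?_
    rintro x ⟨y, -, hy⟩
    rw [LinearMap.mem_ker, LinearMap.domRestrict_apply]
    exact (congrArg g hy).symm.trans (hfg y)
  have h5 : ((Module.finrank k (moduleFiltration k 𝔤 V₁ n) : ℝ) +
      Module.finrank k (moduleFiltration k 𝔤 (V₂.map (g.restrictScalars k)) n)) ≤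
      Module.finrank k W := by
    exact_mod_cast (by omega)
  linarith

theorem GrowthGE.le_of_growthLE (h : GrowthGE k 𝔤 M c d) (h' : GrowthLE k 𝔤 M c' d) :
    c ≤ c' := by
  obtain ⟨V, hV, h⟩ := h
  obtain ⟨n, ⟨h1, h2⟩, hn⟩ := ((h.and (h' V hV)).and (eventually_gt_atTop 0)).exists
  have : (0 : ℝ) < (n : ℝ) ^ d := by positivity
  exact le_of_mul_le_mul_right (h1.trans h2) this

theorem GrowthGE.degree_le_of_growthLE (hc : 0 < c) (h : GrowthGE k 𝔤 M c d)
    (h' : GrowthLE k 𝔤 M c' d') : d ≤ d' := by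
  by_contra! hlt
  obtain ⟨V, hV, h⟩ := h
  obtain ⟨e, rfl⟩ := Nat.exists_eq_add_of_lt hlt
  have ht : Tendsto (fun n : ℕ => c * (n : ℝ) ^ (e + 1)) atTop atTop :=
    ((tendsto_pow_atTop (Nat.succ_ne_zero e)).comp tendsto_natCast_atTop_atTop).const_mul_atTop hc
  obtain ⟨n, ⟨⟨h1, h2⟩, hn⟩, h3⟩ :=
    (((h.and (h' V hV)).and (eventually_gt_atTop 0)).and (ht.eventually_gt_atTop c')).exists
  have hpos : (0 : ℝ) < (n : ℝ) ^ d' := by positivity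
  have h4 : c * (n : ℝ) ^ (e + 1) * (n : ℝ) ^ d' ≤ c' * (n : ℝ) ^ d' := by
    refine le_trans (le_of_eq ?_) (h1.trans h2)
    ring
  exact absurd (le_of_mul_le_mul_right h4 hpos) (not_le.2 h3)

theorem HasGKDim.growthGE (h : HasGKDim k 𝔤 M d) : GrowthGE k 𝔤 M (1 / (2 * d.factorial)) d := by
  obtain ⟨M₀, hM₀, -, a, n₀, ha, h⟩ := h
  exact ⟨M₀, hM₀, (binomial_growth ha h).1⟩

theorem HasGKDim.exists_growthLE [FiniteDimensional k 𝔤] (h : HasGKDim k 𝔤 M d) :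
    ∃ C, GrowthLE k 𝔤 M C d := by
  obtain ⟨M₀, hM₀, hgen, a, n₀, ha, h⟩ := h
  obtain ⟨C, hC⟩ := (binomial_growth ha h).2
  -- Since `V ⊆ U_c M₀`, also `U_n V ⊆ U_{n+c} M₀`, and `n + c ≤ 2n` once `n ≥ c`. The absolute
  -- value is there because the sign of `C` is not recorded.
  refine ⟨|C| * 2 ^ d, fun V hV => ?_⟩
  obtain ⟨c, hc⟩ := exists_le_moduleFiltration hV hgen
  filter_upwards [(tendsto_add_atTop_nat c).eventually hC, eventually_ge_atTop c] with n hn hcn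
  have := Module.Finite.iff_fg.2 (fg_moduleFiltration (𝔤 := 𝔤) hM₀ (n + c))
  have h1 : (Module.finrank k (moduleFiltration k 𝔤 V n) : ℝ) ≤
      Module.finrank k (moduleFiltration k 𝔤 M₀ (n + c)) := by
    exact_mod_cast Submodule.finrank_mono (moduleFiltration_le_add hc n)
  have h2 : ((n + c : ℕ) : ℝ) ≤ 2 * n := by
    push_cast
    have : (c : ℝ) ≤ n := by exact_mod_cast hcn
    linarith
  calc (Module.finrank k (moduleFiltration k 𝔤 V n) : ℝ)
      ≤ C * ((n + c : ℕ) : ℝ) ^ d := h1.trans hn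
    _ ≤ |C| * (2 * (n : ℝ)) ^ d := by
      gcongr
      exact le_abs_self C
    _ = |C| * 2 ^ d * (n : ℝ) ^ d := by rw [mul_pow, mul_assoc]

end Growth

/-! ### From `𝔤`-equivariance to `U(𝔤)`-linearity -/

section Equivariant

open UniversalEnvelopingAlgebra

variable {k : Type*} [Field k] {𝔤 : Type*} [LieRing 𝔤] [LieAlgebra k 𝔤]
  {M : Type*} [AddCommGroup M] [Module k M] [Module (UniversalEnvelopingAlgebra k 𝔤) M]
  [IsScalarTower k (UniversalEnvelopingAlgebra k 𝔤) M]
  {M' : Type*} [AddCommGroup M'] [Module k M'] [Module (UniversalEnvelopingAlgebra k 𝔤) M']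
  [IsScalarTower k (UniversalEnvelopingAlgebra k 𝔤) M']

/-- A `k`-linear map that commutes with the action of `𝔤` is `U(𝔤)`-linear. -/
def LinearMap.ofLieEquivariant (f : M →ₗ[k] M') (h : ∀ (x : 𝔤) m, f (ι k x • m) = ι k x • f m) :
    M →ₗ[UniversalEnvelopingAlgebra k 𝔤] M' where
  toFun := f
  map_add' := map_add f
  map_smul' u := by
    let A : Subalgebra k (UniversalEnvelopingAlgebra k 𝔤) :=
      { carrier := {u | ∀ m, f (u • m) = u • f m}
        mul_mem' := fun {u v} hu hv m => by rw [mul_smul, mul_smul, hu, hv]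
        add_mem' := fun {u v} hu hv m => by rw [add_smul, add_smul, map_add, hu, hv]
        algebraMap_mem' := fun c m => by rw [algebraMap_smul, algebraMap_smul, map_smul] }
    exact mem_subalgebra_of_ι_mem A h u

/-- A `k`-subspace that is stable under `𝔤` is a `U(𝔤)`-submodule. -/
def Submodule.ofLieStable (P : Submodule k M) (h : ∀ (x : 𝔤), ∀ m ∈ P, ι k x • m ∈ P) :
    Submodule (UniversalEnvelopingAlgebra k 𝔤) M where
  carrier := P
  add_mem' := P.add_mem
  zero_mem' := P.zero_mem
  smul_mem' u := by
    let A : Subalgebra k (UniversalEnvelopingAlgebra k 𝔤) :=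
      { carrier := {u | ∀ m ∈ P, u • m ∈ P}
        mul_mem' := fun {u v} hu hv m hm => by
          rw [mul_smul]
          exact hu _ (hv _ hm)
        add_mem' := fun {u v} hu hv m hm => by
          rw [add_smul]
          exact P.add_mem (hu _ hm) (hv _ hm)
        algebraMap_mem' := fun c m hm => by
          rw [algebraMap_smul]
          exact P.smul_mem c hm }
    exact fun {m} hm => mem_subalgebra_of_ι_mem A h u m hm

end Equivariant

/-! ### Growth and finite generation of tensor products -/

section Tensor

open UniversalEnvelopingAlgebra

variable {k : Type*} [Field k] {𝔤 : Type*} [LieRing 𝔤] [LieAlgebra k 𝔤]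
  {M : Type*} [AddCommGroup M] [Module k M] [Module (UniversalEnvelopingAlgebra k 𝔤) M]
  [IsScalarTower k (UniversalEnvelopingAlgebra k 𝔤) M]
  {E : Type*} [AddCommGroup E] [Module k E] [Module (UniversalEnvelopingAlgebra k 𝔤) E]
  [IsScalarTower k (UniversalEnvelopingAlgebra k 𝔤) E]

variable (k M E) in
/-- Pure tensors in `UTensor k M E`. -/
def utmul : M →ₗ[k] E →ₗ[k] UTensor k M E :=
  (TensorProduct.mk k M E).compr₂ (utensorEquiv k M E).toLinearMap

theorem ι_smul_utmul (x : 𝔤) (m : M) (e : E) :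
    ι k x • utmul k M E m e = utmul k M E (ι k x • m) e + utmul k M E m (ι k x • e) :=
  ι_smul_tmul k x m e

@[elab_as_elim]
theorem utensor_induction {p : UTensor k M E → Prop} (t : UTensor k M E) (zero : p 0)
    (utmul : ∀ m e, p (utmul k M E m e)) (add : ∀ s t, p s → p t → p (s + t)) : p t :=
  TensorProduct.induction_on (motive := fun t : M ⊗[k] E => p t) t zero utmul add

/-- The linear map on `UTensor k M E` that corresponds to a bilinear map. -/
def utensorLift {P : Type*} [AddCommGroup P] [Module k P] (f : M →ₗ[k] E →ₗ[k] P) :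
    UTensor k M E →ₗ[k] P :=
  TensorProduct.lift f ∘ₗ (utensorEquiv k M E).symm.toLinearMap

theorem utensorLift_utmul {P : Type*} [AddCommGroup P] [Module k P] (f : M →ₗ[k] E →ₗ[k] P)
    (m : M) (e : E) : utensorLift f (utmul k M E m e) = f m e :=
  TensorProduct.lift.tmul m e

variable (E) in
/-- The subspace `V ⊗ E` of `M ⊗ E`. -/
def tensorSubspace (V : Submodule k M) : Submodule k (UTensor k M E) :=
  Submodule.map₂ (utmul k M E) V ⊤

theorem utmul_mem_tensorSubspace {V : Submodule k M} {m : M} (hm : m ∈ V) (e : E) :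
    utmul k M E m e ∈ tensorSubspace E V :=
  Submodule.apply_mem_map₂ _ hm trivial

theorem tensorSubspace_mono {V W : Submodule k M} (h : V ≤ W) :
    tensorSubspace E V ≤ tensorSubspace E W :=
  Submodule.map₂_le_map₂ h le_rfl

theorem fg_tensorSubspace [FiniteDimensional k E] {V : Submodule k M} (hV : V.FG) :
    (tensorSubspace E V).FG :=
  hV.map₂ _ Module.Finite.fg_top

theorem finrank_tensorSubspace_le [FiniteDimensional k E] {V : Submodule k M} (hV : V.FG) :
    Module.finrank k (tensorSubspace E V) ≤ Module.finrank k V * Module.finrank k E := by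
  have : Module.Finite k V := Module.Finite.iff_fg.2 hV
  have h : tensorSubspace E V =
      LinearMap.range (TensorProduct.lift ((utmul k M E).comp V.subtype)) := by
    apply le_antisymm
    · refine Submodule.map₂_le.2 fun m hm e _ => ⟨(⟨m, hm⟩ : V) ⊗ₜ e, ?_⟩
      rw [TensorProduct.lift.tmul]
      rfl
    · rintro _ ⟨t, rfl⟩
      induction t using TensorProduct.induction_on with
      | zero => simp
      | tmul m e =>
        rw [TensorProduct.lift.tmul]
        exact utmul_mem_tensorSubspace m.2 e
      | add s t hs ht =>
        rw [map_add]
        exact Submodule.add_mem _ hs ht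
  rw [h, ← Module.finrank_tensorProduct]
  exact LinearMap.finrank_range_le _

theorem exists_le_tensorSubspace {W : Submodule k (UTensor k M E)} (hW : W.FG) :
    ∃ V : Submodule k M, V.FG ∧ W ≤ tensorSubspace E V := by
  induction W, hW using Submodule.fg_induction with
  | singleton t =>
    induction t using utensor_induction with
    | zero => exact ⟨⊥, Submodule.fg_bot, by simp⟩
    | utmul m e =>
      exact ⟨Submodule.span k {m}, Submodule.fg_span_singleton m,
        (Submodule.span_singleton_le_iff_mem _ _).2
          (utmul_mem_tensorSubspace (Submodule.mem_span_singleton_self m) e)⟩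
    | add s t hs ht =>
      obtain ⟨V₁, h₁, hs⟩ := hs
      obtain ⟨V₂, h₂, ht⟩ := ht
      rw [Submodule.span_singleton_le_iff_mem] at hs ht
      exact ⟨V₁ ⊔ V₂, h₁.sup h₂, (Submodule.span_singleton_le_iff_mem _ _).2
        (Submodule.add_mem _ (tensorSubspace_mono le_sup_left hs)
          (tensorSubspace_mono le_sup_right ht))⟩
  | sup W₁ W₂ _ _ h₁ h₂ =>
    obtain ⟨V₁, h₁, hs⟩ := h₁
    obtain ⟨V₂, h₂, ht⟩ := h₂
    exact ⟨V₁ ⊔ V₂, h₁.sup h₂, sup_le (hs.trans (tensorSubspace_mono le_sup_left))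
      (ht.trans (tensorSubspace_mono le_sup_right))⟩

theorem ι_smul_mem_tensorSubspace {V : Submodule k M} {n : ℕ} (x : 𝔤) {t : UTensor k M E}
    (ht : t ∈ tensorSubspace E (moduleFiltration k 𝔤 V n)) :
    ι k x • t ∈ tensorSubspace E (moduleFiltration k 𝔤 V (n + 1)) := by
  rw [tensorSubspace, Submodule.map₂_eq_span_image2] at ht
  refine smul_mem_of_mem_span_right ?_ ht
  rintro _ ⟨m, hm, e, -, rfl⟩
  rw [ι_smul_utmul]
  refine Submodule.add_mem _ (utmul_mem_tensorSubspace ?_ e)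
    (utmul_mem_tensorSubspace (moduleFiltration_mono_right V (Nat.le_succ n) hm) _)
  rw [add_comm]
  exact smul_mem_moduleFiltration_add (ι_mem_envelopingFiltration x) hm

/-- By the Leibniz rule each factor from `𝔤` raises the filtration degree in `M` by at most one,
while `E` absorbs its own action. -/
theorem moduleFiltration_tensorSubspace_le (V : Submodule k M) (n : ℕ) :
    moduleFiltration k 𝔤 (tensorSubspace E V) n ≤ tensorSubspace E (moduleFiltration k 𝔤 V n) := by
  refine Submodule.span_le.2 ?_
  rintro _ ⟨u, hu, t, ht, rfl⟩
  refine smul_mem_of_mem_span ?_ hu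
  rintro _ ⟨l, hl, rfl⟩
  refine tensorSubspace_mono (moduleFiltration_mono_right V hl) ?_
  clear hl
  induction l with
  | nil =>
    simp only [List.map_nil, List.prod_nil, one_smul, List.length_nil]
    refine tensorSubspace_mono (fun v hv => ?_) ht
    simpa using smul_mem_moduleFiltration (one_mem_envelopingFiltration 0) hv
  | cons x l ih =>
    rw [List.map_cons, List.prod_cons, mul_smul, List.length_cons]
    exact ι_smul_mem_tensorSubspace x ih

theorem finrank_moduleFiltration_tensorSubspace_le [FiniteDimensional k 𝔤] [FiniteDimensional k E]
    {V : Submodule k M} (hV : V.FG) {W : Submodule k (UTensor k M E)}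
    (hW : W ≤ tensorSubspace E V) (n : ℕ) :
    (Module.finrank k (moduleFiltration k 𝔤 W n) : ℝ) ≤
      Module.finrank k (moduleFiltration k 𝔤 V n) * Module.finrank k E := by
  have hfg := fg_moduleFiltration (𝔤 := 𝔤) hV n
  have := Module.Finite.iff_fg.2 (fg_tensorSubspace (E := E) hfg)
  exact_mod_cast (Submodule.finrank_mono ((moduleFiltration_mono hW n).trans
    (moduleFiltration_tensorSubspace_le V n))).trans (finrank_tensorSubspace_le hfg)

variable {c : ℝ} {d : ℕ}

/-- Every finite dimensional subspace of `M ⊗ E` lies in some `V ⊗ E`, where dimensions are at most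
`dim E` times those in `M`. The added `1` keeps the denominator positive when `E = 0`. -/
theorem GrowthGE.of_utensor [FiniteDimensional k 𝔤] [FiniteDimensional k E]
    (h : GrowthGE k 𝔤 (UTensor k M E) c d) :
    GrowthGE k 𝔤 M (c / (Module.finrank k E + 1)) d := by
  obtain ⟨W, hW, h⟩ := h
  obtain ⟨V, hV, hWV⟩ := exists_le_tensorSubspace hW
  refine ⟨V, hV, h.mono fun n hn => ?_⟩
  rw [div_mul_eq_mul_div, div_le_iff₀ (by positivity)]
  refine (hn.trans (finrank_moduleFiltration_tensorSubspace_le hV hWV n)).trans ?_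
  gcongr
  linarith

theorem GrowthLE.utensor [FiniteDimensional k 𝔤] [FiniteDimensional k E]
    (h : GrowthLE k 𝔤 M c d) : GrowthLE k 𝔤 (UTensor k M E) (c * Module.finrank k E) d := by
  intro W hW
  obtain ⟨V, hV, hWV⟩ := exists_le_tensorSubspace hW
  refine (h V hV).mono fun n hn => ?_
  refine (finrank_moduleFiltration_tensorSubspace_le hV hWV n).trans ?_
  rw [mul_right_comm]
  gcongr

variable (k 𝔤 M E) in
theorem finite_utensor [FiniteDimensional k E] [Module.Finite (UniversalEnvelopingAlgebra k 𝔤) M] :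
    Module.Finite (UniversalEnvelopingAlgebra k 𝔤) (UTensor k M E) := by
  obtain ⟨s, hs⟩ := Module.Finite.fg_top (R := UniversalEnvelopingAlgebra k 𝔤) (M := M)
  obtain ⟨t, ht⟩ := fg_tensorSubspace (E := E) (Submodule.fg_span (R := k) s.finite_toSet)
  refine ⟨⟨t, ?_⟩⟩
  set P := Submodule.span (UniversalEnvelopingAlgebra k 𝔤) (t : Set (UTensor k M E)) with hP
  have hle : ∀ m ∈ s, ∀ e, utmul k M E m e ∈ P := by
    intro m hm e
    rw [hP, ← Submodule.span_span_of_tower k, ht]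
    exact Submodule.subset_span (utmul_mem_tensorSubspace (Submodule.subset_span hm) e)
  let Q₀ : Submodule k M :=
    { carrier := {m | ∀ e, utmul k M E m e ∈ P}
      add_mem' := fun {m m'} hm hm' e => by
        rw [map_add, LinearMap.add_apply]
        exact P.add_mem (hm e) (hm' e)
      zero_mem' := fun e => by simp
      smul_mem' := fun c m hm e => by
        rw [map_smul, LinearMap.smul_apply]
        exact (P.restrictScalars k).smul_mem c (hm e) }
  -- The set of `m` with `m ⊗ E ⊆ P` is stable under `𝔤`, because `x m ⊗ e = x (m ⊗ e) - m ⊗ x e`.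
  -- It contains the generators of `M`, hence is everything.
  let Q := Submodule.ofLieStable (𝔤 := 𝔤) Q₀ fun x m hm e => by
    rw [← add_sub_cancel_right (utmul k M E (ι k x • m) e) (utmul k M E m (ι k x • e)),
      ← ι_smul_utmul]
    exact P.sub_mem (P.smul_mem _ (hm e)) (hm _)
  have hQ : Q = ⊤ := by
    rw [eq_top_iff, ← hs]
    exact Submodule.span_le.2 hle
  rw [eq_top_iff]
  intro x _
  induction x using utensor_induction with
  | zero => exact P.zero_mem
  | utmul m e =>
    have hm : m ∈ Q := hQ ▸ trivial
    exact hm e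
  | add x y hx hy => exact P.add_mem (hx trivial) (hy trivial)

end Tensor

/-! ### Adjunction between tensoring with a module and with its dual -/

section Adjunction

set_option linter.unusedSectionVars false

open UniversalEnvelopingAlgebra

variable (k : Type*) [Field k] (𝔤 : Type*) [LieRing 𝔤] [LieAlgebra k 𝔤]
  (E : Type*) [AddCommGroup E] [Module k E] [Module (UniversalEnvelopingAlgebra k 𝔤) E]
  (F : Type*) [AddCommGroup F] [Module k F] [Module (UniversalEnvelopingAlgebra k 𝔤) F]

/-- An invariant bilinear pairing of two finite dimensional modules with a pair of dual bases. -/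
structure InvariantPairing where
  /-- the bilinear form -/
  form : E →ₗ[k] F →ₗ[k] k
  /-- the index set of the dual bases -/
  index : Type
  [fintypeIndex : Fintype index]
  /-- the basis of the first module -/
  left : index → E
  /-- the basis of the second module -/
  right : index → F
  invariant : ∀ (x : 𝔤) e f, form (ι k x • e) f = -form e (ι k x • f)
  sum_left : ∀ e, ∑ i, form e (right i) • left i = e
  sum_right : ∀ f, ∑ i, form (left i) f • right i = f

attribute [instance] InvariantPairing.fintypeIndex

variable {k 𝔤 E F}
variable [IsScalarTower k (UniversalEnvelopingAlgebra k 𝔤) E]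
  [IsScalarTower k (UniversalEnvelopingAlgebra k 𝔤) F]
  {M : Type*} [AddCommGroup M] [Module k M] [Module (UniversalEnvelopingAlgebra k 𝔤) M]
  [IsScalarTower k (UniversalEnvelopingAlgebra k 𝔤) M]
  {N : Type*} [AddCommGroup N] [Module k N] [Module (UniversalEnvelopingAlgebra k 𝔤) N]
  [IsScalarTower k (UniversalEnvelopingAlgebra k 𝔤) N]

namespace InvariantPairing

/-- The pairing with the roles of the two modules exchanged. -/
def flip (β : InvariantPairing k 𝔤 E F) : InvariantPairing k 𝔤 F E where
  form := β.form.flip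
  index := β.index
  left := β.right
  right := β.left
  invariant x f e := by
    simp only [LinearMap.flip_apply]
    rw [β.invariant, neg_neg]
  sum_left := β.sum_right
  sum_right := β.sum_left

variable (M) in
/-- The contraction `(M ⊗ E) × F → M`. -/
def contract (β : InvariantPairing k 𝔤 E F) : UTensor k M E →ₗ[k] F →ₗ[k] M :=
  utensorLift (((LinearMap.llcomp k F k M).comp (LinearMap.lsmul k M).flip).compl₂ β.form)

theorem contract_utmul (β : InvariantPairing k 𝔤 E F) (m : M) (e : E) (f : F) :
    β.contract M (utmul k M E m e) f = β.form e f • m := by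
  rw [contract, utensorLift_utmul]
  rfl

theorem contract_ι_smul (β : InvariantPairing k 𝔤 E F) (x : 𝔤) (t : UTensor k M E) (f : F) :
    β.contract M (ι k x • t) f = ι k x • β.contract M t f - β.contract M t (ι k x • f) := by
  induction t using utensor_induction with
  | zero => simp
  | utmul m e =>
    rw [ι_smul_utmul, map_add, LinearMap.add_apply, contract_utmul, contract_utmul, contract_utmul,
      contract_utmul, β.invariant, neg_smul, smul_algebra_smul_comm, sub_eq_add_neg]
  | add s t hs ht =>
    simp only [smul_add, map_add, LinearMap.add_apply, hs, ht]
    abel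

theorem sum_contract (β : InvariantPairing k 𝔤 E F) (t : UTensor k M E) :
    ∑ i, utmul k M E (β.contract M t (β.right i)) (β.left i) = t := by
  induction t using utensor_induction with
  | zero => simp
  | utmul m e =>
    simp only [contract_utmul, map_smul, LinearMap.smul_apply]
    conv_rhs => rw [← β.sum_left e, map_sum]
    simp only [map_smul]
  | add s t hs ht =>
    simp only [map_add, LinearMap.add_apply, Finset.sum_add_distrib, hs, ht]

theorem contract_injective (β : InvariantPairing k 𝔤 E F) {s t : UTensor k M E}
    (h : ∀ f, β.contract M s f = β.contract M t f) : s = t := by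
  rw [← β.sum_contract s, ← β.sum_contract t]
  simp only [h]

theorem contract_sum (β : InvariantPairing k 𝔤 E F) (φ : F →ₗ[k] M) (f : F) :
    β.contract M (∑ i, utmul k M E (φ (β.right i)) (β.left i)) f = φ f := by
  simp only [map_sum, LinearMap.sum_apply, contract_utmul, ← map_smul]
  rw [← map_sum, β.sum_right]

/-- Tensoring with `F` is left adjoint to tensoring with `E`; here only the existence of non-zero
morphisms is recorded. -/
theorem exists_ne_zero_iff (β : InvariantPairing k 𝔤 E F) :
    (∃ φ : UTensor k N F →ₗ[UniversalEnvelopingAlgebra k 𝔤] M, φ ≠ 0) ↔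
      ∃ ψ : N →ₗ[UniversalEnvelopingAlgebra k 𝔤] UTensor k M E, ψ ≠ 0 := by
  constructor
  · rintro ⟨φ, hφ⟩
    -- The transpose of `φ` sends `n` to the tensor whose contraction with each `f` is `φ (n ⊗ f)`;
    -- dual bases write it down. Equivariance is then tested on contractions.
    let ψ₀ : N →ₗ[k] UTensor k M E := ∑ i, (utmul k M E).flip (β.left i) ∘ₗ
      φ.restrictScalars k ∘ₗ (utmul k N F).flip (β.right i)
    have hψ₀ : ∀ n f, β.contract M (ψ₀ n) f = φ (utmul k N F n f) := by
      intro n f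
      rw [show ψ₀ n = ∑ i, utmul k M E (φ (utmul k N F n (β.right i))) (β.left i) by
        simp only [ψ₀, LinearMap.sum_apply]
        rfl]
      exact contract_sum β (φ.restrictScalars k ∘ₗ utmul k N F n) f
    refine ⟨ψ₀.ofLieEquivariant fun x n => β.contract_injective fun f => ?_, fun h => hφ ?_⟩
    · rw [contract_ι_smul, hψ₀, hψ₀, hψ₀, ← map_smul, ι_smul_utmul, map_add, add_sub_cancel_right]
    · have h0 : ∀ n, ψ₀ n = 0 := fun n => LinearMap.congr_fun h n
      ext t
      induction t using utensor_induction with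
      | zero => simp
      | utmul n f => rw [← hψ₀, h0, map_zero, LinearMap.zero_apply, LinearMap.zero_apply]
      | add s t hs ht => rw [map_add, map_add, hs, ht]
  · rintro ⟨ψ, hψ⟩
    let φ₀ : UTensor k N F →ₗ[k] M := utensorLift (β.contract M ∘ₗ ψ.restrictScalars k)
    have hφ₀ : ∀ n f, φ₀ (utmul k N F n f) = β.contract M (ψ n) f := fun n f =>
      utensorLift_utmul _ n f
    refine ⟨φ₀.ofLieEquivariant fun x t => ?_, fun h => hψ ?_⟩
    · induction t using utensor_induction with
      | zero => simp
      | utmul n f => rw [ι_smul_utmul, map_add, hφ₀, hφ₀, hφ₀, map_smul, contract_ι_smul,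
          sub_add_cancel]
      | add s t hs ht => rw [smul_add, map_add, map_add, smul_add, hs, ht]
    · have h0 : ∀ t, φ₀ t = 0 := fun t => LinearMap.congr_fun h t
      ext n
      refine β.contract_injective fun f => ?_
      rw [← hφ₀, h0, LinearMap.zero_apply, map_zero, LinearMap.zero_apply]

variable (k 𝔤 E) in
/-- The evaluation pairing of a finite dimensional module and its dual. -/
def dual [FiniteDimensional k E] : InvariantPairing k 𝔤 E (UDual k E) where
  form := (Module.Dual.eval k E).compl₂ (udualEquiv k E).symm.toLinearMap
  index := Fin (Module.finrank k E)
  left := Module.finBasis k E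
  right i := udualEquiv k E ((Module.finBasis k E).coord i)
  invariant x e f := by
    have := ι_smul_dual_apply k x f e
    simp only [LinearMap.compl₂_apply, Module.Dual.eval_apply, LinearEquiv.coe_coe, this, neg_neg]
  sum_left e := (Module.finBasis k E).sum_repr e
  sum_right f := (udualEquiv k E).symm.injective <| (Module.finBasis k E).ext fun j => by
    simp [LinearMap.compl₂_apply]

end InvariantPairing

end Adjunction

/-! ### Socles, radicals and subquotients over a general ring -/

section SocleRadical

variable {R : Type*} [Ring R] {M : Type*} [AddCommGroup M] [Module R M]

variable (R M) in
theorem isSemisimpleModule_moduleSocle : IsSemisimpleModule R (moduleSocle R M) := by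
  rw [moduleSocle, sSup_eq_iSup]
  exact isSemisimpleModule_biSup_of_isSemisimpleModule_submodule fun N hN => by
    have : IsSimpleModule R N := hN
    infer_instance

variable (R M) in
theorem isFiniteLength_moduleSocle [IsNoetherian R M] : IsFiniteLength R (moduleSocle R M) := by
  have := isSemisimpleModule_moduleSocle R M
  exact isFiniteLength_iff_isNoetherian_isArtinian.2 ⟨inferInstance, inferInstance⟩

/-- A non-zero intersection with the socle is semisimple, so it contains a simple submodule. -/
theorem isEssentialSubmodule_moduleSocle_iff :
    IsEssentialSubmodule (moduleSocle R M) ↔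
      ∀ K : Submodule R M, K ≠ ⊥ → ∃ L ≤ K, IsSimpleModule R L := by
  constructor
  · intro h K hK
    have hne : K ⊓ moduleSocle R M ≠ ⊥ := fun h0 => hK (h K h0)
    have := isSemisimpleModule_moduleSocle R M
    have : IsSemisimpleModule R (K ⊓ moduleSocle R M : Submodule R M) :=
      IsSemisimpleModule.of_injective (Submodule.inclusion inf_le_right)
        (Submodule.inclusion_injective _)
    obtain h0 | ⟨L, hL, hs⟩ :=
      IsSemisimpleModule.eq_bot_or_exists_simple_le (K ⊓ moduleSocle R M)
    · exact absurd h0 hne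
    · exact ⟨L, hL.trans inf_le_left, hs⟩
  · intro h K hK
    by_contra hne
    obtain ⟨L, hL, hs⟩ := h K hne
    have hbot : L = ⊥ := le_bot_iff.1 (hK ▸ le_inf hL (le_sSup hs))
    exact (isSimpleModule_iff_isAtom.1 hs).1 hbot

theorem isSuperfluousSubmodule_moduleRadical [Module.Finite R M] :
    IsSuperfluousSubmodule (moduleRadical R M) := by
  intro K hK
  by_contra hne
  obtain ⟨C, hC, hKC⟩ := (eq_top_or_exists_le_coatom K).resolve_left hne
  exact hC.1 (top_le_iff.1 (hK ▸ sup_le hKC (sInf_le hC)))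

variable {M' : Type*} [AddCommGroup M'] [Module R M']

/-- The image of a subquotient under an injective map. -/
def subquotientMapEquiv {f : M →ₗ[R] M'} (hf : Function.Injective f) (N₁ N₂ : Submodule R M) :
    Subquotient N₁ N₂ ≃ₗ[R] Subquotient (N₁.map f) (N₂.map f) :=
  Submodule.Quotient.equiv _ _ (Submodule.equivMapOfInjective f hf N₂) <| by
    ext ⟨_, x, hx, rfl⟩
    constructor
    · rintro ⟨y, hy, hyx⟩
      exact ⟨y, hy, congrArg Subtype.val hyx⟩
    · rintro ⟨y, hy, hyx⟩
      obtain rfl : y = x := hf hyx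
      exact ⟨⟨y, hx⟩, hy, rfl⟩

/-- A submodule of the range is a subquotient of the domain. -/
def subquotientComapEquiv (f : M →ₗ[R] M') {L : Submodule R M'} (hL : L ≤ LinearMap.range f) :
    Subquotient (LinearMap.ker f) (L.comap f) ≃ₗ[R] L :=
  (Submodule.quotEquivOfEq _ _ (by
    ext x
    simp [Submodule.submoduleOf, LinearMap.restrict])).trans
    ((f.restrict (p := L.comap f) (q := L) fun _ hx => hx).quotKerEquivOfSurjective (by
      rintro ⟨y, hy⟩
      obtain ⟨x, rfl⟩ := hL hy
      exact ⟨⟨x, hy⟩, rfl⟩))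

end SocleRadical

/-! ### Bounding the number of layers by growth -/

section Applications

set_option linter.unusedSectionVars false

open UniversalEnvelopingAlgebra

variable {k : Type*} [Field k] {𝔤 : Type*} [LieRing 𝔤] [LieAlgebra k 𝔤] [FiniteDimensional k 𝔤]
  {M : Type*} [AddCommGroup M] [Module k M] [Module (UniversalEnvelopingAlgebra k 𝔤) M]
  [IsScalarTower k (UniversalEnvelopingAlgebra k 𝔤) M]
  {c C : ℝ} {d d' : ℕ}

theorem HasGKDim.unique (h : HasGKDim k 𝔤 M d) (h' : HasGKDim k 𝔤 M d') : d = d' := by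
  obtain ⟨C, hC⟩ := h.exists_growthLE
  obtain ⟨C', hC'⟩ := h'.exists_growthLE
  exact le_antisymm (h.growthGE.degree_le_of_growthLE (by positivity) hC')
    (h'.growthGE.degree_le_of_growthLE (by positivity) hC)

variable (k 𝔤 M) in
theorem exists_hasGKDim_of_isSimpleModule [IsSimpleModule (UniversalEnvelopingAlgebra k 𝔤) M] :
    ∃ d, HasGKDim k 𝔤 M d := by
  have := IsSimpleModule.nontrivial (UniversalEnvelopingAlgebra k 𝔤) M
  obtain ⟨m, hm⟩ := exists_ne (0 : M)
  exact exists_hasGKDim_of_span_singleton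
    (IsSimpleModule.span_singleton_eq_top (UniversalEnvelopingAlgebra k 𝔤) hm)

variable (k 𝔤 M d) in
theorem growthGE_zero : GrowthGE k 𝔤 M 0 d :=
  ⟨⊥, Submodule.fg_bot, Filter.Eventually.of_forall fun n => by
    rw [zero_mul]
    positivity⟩

/-- If the quotients by maximal submodules grow uniformly as fast as the module itself, then only
finitely many of them are needed to cut out the radical. -/
theorem hasFiniteTypeRadical_of_growth [Module.Finite (UniversalEnvelopingAlgebra k 𝔤) M]
    (hc : 0 < c)
    (hge : ∀ K : Submodule (UniversalEnvelopingAlgebra k 𝔤) M, IsCoatom K →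
      GrowthGE k 𝔤 (M ⧸ K) c d)
    (hle : GrowthLE k 𝔤 M C d) : HasFiniteTypeRadical (UniversalEnvelopingAlgebra k 𝔤) M := by
  refine ⟨?_, isSuperfluousSubmodule_moduleRadical⟩
  have hN := isNoetherianRing_universalEnvelopingAlgebra k 𝔤
  by_contra hrad
  -- `N` is an intersection of `j` maximal submodules, each of which strictly shrinks the previous
  -- intersection. Infinite length of `M / rad M` means that this never stops, since `N` cannot
  -- equal the radical while `M / N` has finite length.
  have key : ∀ j : ℕ, ∃ N : Submodule (UniversalEnvelopingAlgebra k 𝔤) M,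
      moduleRadical (UniversalEnvelopingAlgebra k 𝔤) M ≤ N ∧
      IsArtinian (UniversalEnvelopingAlgebra k 𝔤) (M ⧸ N) ∧
      GrowthGE k 𝔤 (M ⧸ N) (j * c) d := by
    intro j
    induction j with
    | zero =>
      refine ⟨⊤, le_top, ?_, ?_⟩
      · have := Submodule.Quotient.subsingleton_iff.2
          (rfl : (⊤ : Submodule (UniversalEnvelopingAlgebra k 𝔤) M) = ⊤)
        infer_instance
      · rw [Nat.cast_zero, zero_mul]
        exact growthGE_zero k 𝔤 _ d
    | succ j ih =>
      obtain ⟨N, hradN, hart, hgr⟩ := ih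
      have hnot : ¬ N ≤ moduleRadical (UniversalEnvelopingAlgebra k 𝔤) M := by
        intro h
        refine hrad ?_
        rw [← le_antisymm h hradN]
        exact isFiniteLength_iff_isNoetherian_isArtinian.2 ⟨inferInstance, hart⟩
      obtain ⟨K, hK, hNK⟩ : ∃ K : Submodule (UniversalEnvelopingAlgebra k 𝔤) M,
          IsCoatom K ∧ ¬ N ≤ K := by
        by_contra! h
        exact hnot (le_sInf h)
      have hsup : N ⊔ K = ⊤ := hK.2 _ (right_lt_sup.2 hNK)
      have hsimple : IsSimpleModule (UniversalEnvelopingAlgebra k 𝔤) (M ⧸ K) :=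
        isSimpleModule_iff_isCoatom.2 hK
      have hartK : IsArtinian (UniversalEnvelopingAlgebra k 𝔤) (M ⧸ K) := inferInstance
      -- `M / (N ⊓ K)` is an extension of `M / N` by `N / (N ⊓ K) ≃ M / K`
      let π : (M ⧸ (N ⊓ K)) →ₗ[UniversalEnvelopingAlgebra k 𝔤] M ⧸ N :=
        Submodule.factor inf_le_left
      let p : (LinearMap.ker π) →ₗ[UniversalEnvelopingAlgebra k 𝔤] M ⧸ K :=
        (Submodule.factor inf_le_right).comp (LinearMap.ker π).subtype
      have hπ : Function.Surjective π := Submodule.factor_surjective _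
      have hp : Function.Surjective p := by
        intro y
        obtain ⟨m, rfl⟩ := Submodule.Quotient.mk_surjective _ y
        obtain ⟨a, ha, b, hb, rfl⟩ := Submodule.mem_sup.1 (hsup ▸ trivial : m ∈ N ⊔ K)
        refine ⟨⟨Submodule.Quotient.mk a, (Submodule.Quotient.mk_eq_zero N).2 ha⟩, ?_⟩
        refine (Submodule.Quotient.eq K).2 ?_
        rw [LinearMap.id_apply, sub_add_cancel_left]
        exact K.neg_mem hb
      have hpinj : Function.Injective p := by
        rw [injective_iff_map_eq_zero]
        rintro ⟨x, hx⟩ hx'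
        obtain ⟨m, rfl⟩ := Submodule.Quotient.mk_surjective _ x
        refine Subtype.ext ((Submodule.Quotient.mk_eq_zero _).2
          ⟨(Submodule.Quotient.mk_eq_zero N).1 hx, (Submodule.Quotient.mk_eq_zero K).1 hx'⟩)
      refine ⟨N ⊓ K, le_inf hradN (sInf_le hK), ?_, ?_⟩
      · have : IsArtinian (UniversalEnvelopingAlgebra k 𝔤) (LinearMap.ker π) :=
          isArtinian_of_injective p hpinj
        exact isArtinian_of_range_eq_ker (LinearMap.ker π).subtype π
          (Submodule.range_subtype _)
      · have h1 : GrowthGE k 𝔤 (LinearMap.ker π) c d := (hge K hK).of_surjective p hp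
        rw [Nat.cast_succ, add_one_mul, add_comm]
        exact h1.add (Submodule.subtype_injective _) hπ (fun x => x.2) hgr
  obtain ⟨j, hj⟩ := exists_nat_gt (C / c)
  obtain ⟨N, -, -, hgr⟩ := key j
  have h1 := (hgr.of_surjective N.mkQ N.mkQ_surjective).le_of_growthLE hle
  rw [div_lt_iff₀ hc] at hj
  linarith

/-- If every non-zero submodule has a simple subquotient that grows uniformly as fast as the module
itself, then every non-zero submodule has a simple submodule. -/
theorem exists_simple_le_of_growth (hc : 0 < c) (hle : GrowthLE k 𝔤 M C d)
    (hsub : ∀ K : Submodule (UniversalEnvelopingAlgebra k 𝔤) M, K ≠ ⊥ →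
      ∃ N₁ N₂ : Submodule (UniversalEnvelopingAlgebra k 𝔤) M, N₁ ≤ N₂ ∧ N₂ ≤ K ∧
        IsSimpleModule (UniversalEnvelopingAlgebra k 𝔤) (Subquotient N₁ N₂) ∧
        GrowthGE k 𝔤 (Subquotient N₁ N₂) c d)
    (K : Submodule (UniversalEnvelopingAlgebra k 𝔤) M) (hK : K ≠ ⊥) :
    ∃ L ≤ K, IsSimpleModule (UniversalEnvelopingAlgebra k 𝔤) L := by
  by_contra! hno
  -- The claim ranges over all `K` without simple submodules because the induction passes from `K`
  -- to `N₁`, which inherits this property. `N₁` is non-zero: otherwise `N₂` would be a simple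
  -- submodule of `K`.
  have key : ∀ (j : ℕ) (K : Submodule (UniversalEnvelopingAlgebra k 𝔤) M), K ≠ ⊥ →
      (∀ L ≤ K, ¬ IsSimpleModule (UniversalEnvelopingAlgebra k 𝔤) L) →
      GrowthGE k 𝔤 K (j * c) d := by
    intro j
    induction j with
    | zero =>
      intro K _ _
      rw [Nat.cast_zero, zero_mul]
      exact growthGE_zero k 𝔤 _ d
    | succ j ih =>
      intro K hK hno
      obtain ⟨N₁, N₂, h12, h2K, hs, hgr⟩ := hsub K hK
      have hN₁ : N₁ ≠ ⊥ := by
        rintro rfl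
        refine hno N₂ h2K ?_
        have hbot : (⊥ : Submodule (UniversalEnvelopingAlgebra k 𝔤) M).submoduleOf N₂ = ⊥ := by
          simp [Submodule.submoduleOf]
        exact IsSimpleModule.congr (Submodule.quotEquivOfEqBot _ hbot).symm
      have h1 := ih N₁ hN₁ fun L hL => hno L (hL.trans (h12.trans h2K))
      have h2 : GrowthGE k 𝔤 N₂ (j * c + c) d :=
        GrowthGE.add (f := Submodule.inclusion h12) (Submodule.inclusion_injective h12)
          (g := (N₁.submoduleOf N₂).mkQ) (Submodule.mkQ_surjective _)
          (fun x => (Submodule.Quotient.mk_eq_zero _).2 x.2) h1 hgr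
      rw [Nat.cast_succ, add_one_mul]
      exact h2.of_injective (Submodule.inclusion h2K) (Submodule.inclusion_injective h2K)
  obtain ⟨j, hj⟩ := exists_nat_gt (C / c)
  have h1 := ((key j K hK hno).of_injective K.subtype
    (Submodule.subtype_injective K)).le_of_growthLE hle
  rw [div_lt_iff₀ hc] at hj
  linarith

variable {S : Type*} [AddCommGroup S] [Module k S] [Module (UniversalEnvelopingAlgebra k 𝔤) S]
  [IsScalarTower k (UniversalEnvelopingAlgebra k 𝔤) S]
  [IsSimpleModule (UniversalEnvelopingAlgebra k 𝔤) S]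
  {E : Type*} [AddCommGroup E] [Module k E] [Module (UniversalEnvelopingAlgebra k 𝔤) E]
  [IsScalarTower k (UniversalEnvelopingAlgebra k 𝔤) E] [FiniteDimensional k E]

instance : FiniteDimensional k (UDual k E) :=
  inferInstanceAs (FiniteDimensional k (Module.Dual k E))

/-- A simple module that maps non-trivially to `S ⊗ E` has the Gelfand-Kirillov dimension of
`S`. -/
theorem HasGKDim.of_ne_zero_to_utensor (hS : HasGKDim k 𝔤 S d)
    [IsSimpleModule (UniversalEnvelopingAlgebra k 𝔤) M]
    {ψ : M →ₗ[UniversalEnvelopingAlgebra k 𝔤] UTensor k S E} (hψ : ψ ≠ 0) :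
    HasGKDim k 𝔤 M d := by
  obtain ⟨C, hC⟩ := hS.exists_growthLE
  obtain ⟨d', hd'⟩ := exists_hasGKDim_of_isSimpleModule k 𝔤 M
  obtain ⟨C', hC'⟩ := hd'.exists_growthLE
  -- The transpose `M ⊗ E* → S` is onto, so `M` grows at least in degree `d`; the embedding `M → S ⊗
  -- E` bounds the growth from the other side.
  obtain ⟨φ, hφ⟩ := (InvariantPairing.dual k 𝔤 E).exists_ne_zero_iff.2 ⟨ψ, hψ⟩
  have h1 := hS.growthGE.of_surjective φ (LinearMap.surjective_of_ne_zero hφ)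
  have h2 := h1.of_utensor.degree_le_of_growthLE (by positivity) hC'
  have h3 := hd'.growthGE.degree_le_of_growthLE (by positivity)
    ((hC.utensor (E := E)).of_injective ψ (LinearMap.injective_of_ne_zero hψ))
  rwa [le_antisymm h2 h3]

theorem hasFiniteTypeRadical_utensor (hS : HasGKDim k 𝔤 S d) :
    HasFiniteTypeRadical (UniversalEnvelopingAlgebra k 𝔤) (UTensor k S E) := by
  obtain ⟨C, hC⟩ := hS.exists_growthLE
  have := finite_utensor k 𝔤 S E
  refine hasFiniteTypeRadical_of_growth
    (c := 1 / (2 * d.factorial) / (Module.finrank k (UDual k E) + 1)) (by positivity)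
    (fun K hK => ?_) hC.utensor
  have hne : K.mkQ ≠ 0 := by
    intro h
    have hker := K.ker_mkQ
    rw [h, LinearMap.ker_zero] at hker
    exact hK.1 hker.symm
  -- The flipped pairing gives the adjunction with `E` and `E*` exchanged, without identifying `E`
  -- with its bidual. The map `S → (T/K) ⊗ E*` is injective as `S` is simple, and the resulting
  -- constant is independent of `K`.
  obtain ⟨ψ, hψ⟩ := (InvariantPairing.dual k 𝔤 E).flip.exists_ne_zero_iff.1 ⟨K.mkQ, hne⟩
  exact (hS.growthGE.of_injective ψ (LinearMap.injective_of_ne_zero hψ)).of_utensor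

end Applications

end

/-! ### The theorem -/

theorem mainTheorem2
    (k : Type u) [Field k]
    (𝔤 : Type v) [LieRing 𝔤] [LieAlgebra k 𝔤] [FiniteDimensional k 𝔤]
    (S : Type w₁) [AddCommGroup S] [Module k S] [Module (UniversalEnvelopingAlgebra k 𝔤) S]
    [IsScalarTower k (UniversalEnvelopingAlgebra k 𝔤) S]
    [IsSimpleModule (UniversalEnvelopingAlgebra k 𝔤) S]
    (E : Type w₂) [AddCommGroup E] [Module k E] [Module (UniversalEnvelopingAlgebra k 𝔤) E]
    [IsScalarTower k (UniversalEnvelopingAlgebra k 𝔤) E] [FiniteDimensional k E] :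
    HasFiniteTypeRadical (UniversalEnvelopingAlgebra k 𝔤) (UTensor k S E) ∧
    IsFiniteLength (UniversalEnvelopingAlgebra k 𝔤)
      (moduleSocle (UniversalEnvelopingAlgebra k 𝔤) (UTensor k S E)) ∧
    List.TFAE [
      -- (a)
      HasFiniteTypeSocle (UniversalEnvelopingAlgebra k 𝔤) (UTensor k S E),
      -- (b); every finitely generated module is isomorphic to one in the universe of `U(𝔤)`
      ∀ (N : Type (max u v)) [AddCommGroup N] [Module k N]
        [Module (UniversalEnvelopingAlgebra k 𝔤) N]
        [IsScalarTower k (UniversalEnvelopingAlgebra k 𝔤) N]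
        [Module.Finite (UniversalEnvelopingAlgebra k 𝔤) N],
        (∃ f : UTensor k N (UDual k E) →ₗ[UniversalEnvelopingAlgebra k 𝔤] S, f ≠ 0) →
        ∃ N₁ N₂ : Submodule (UniversalEnvelopingAlgebra k 𝔤) N, N₁ ≤ N₂ ∧
          IsSimpleModule (UniversalEnvelopingAlgebra k 𝔤) (Subquotient N₁ N₂) ∧
          ∃ g : UTensor k (Subquotient N₁ N₂) (UDual k E)
            →ₗ[UniversalEnvelopingAlgebra k 𝔤] S, g ≠ 0,
      -- (c)
      ∀ M : Submodule (UniversalEnvelopingAlgebra k 𝔤) (UTensor k S E), M ≠ ⊥ →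
        ∃ N₁ N₂ : Submodule (UniversalEnvelopingAlgebra k 𝔤) (UTensor k S E),
          N₁ ≤ N₂ ∧ N₂ ≤ M ∧
          IsSimpleModule (UniversalEnvelopingAlgebra k 𝔤) (Subquotient N₁ N₂) ∧
          ∃ d : ℕ, HasGKDim k 𝔤 S d ∧ HasGKDim k 𝔤 (Subquotient N₁ N₂) d] := by
  obtain ⟨d, hS⟩ := exists_hasGKDim_of_isSimpleModule k 𝔤 S
  have hU := isNoetherianRing_universalEnvelopingAlgebra k 𝔤
  have hfin := finite_utensor k 𝔤 S E
  refine ⟨hasFiniteTypeRadical_utensor hS, isFiniteLength_moduleSocle _ _, ?_⟩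
  have hadj {N : Type (max u v)} [AddCommGroup N] [Module k N]
      [Module (UniversalEnvelopingAlgebra k 𝔤) N]
      [IsScalarTower k (UniversalEnvelopingAlgebra k 𝔤) N] :=
    (InvariantPairing.dual k 𝔤 E).exists_ne_zero_iff (N := N) (M := S)
  tfae_have 1 → 2 := by
    intro ha N _ _ _ _ _ hf
    obtain ⟨ψ, hψ⟩ := hadj.1 hf
    -- A simple submodule of the image of `ψ` is a subquotient of `N` and embeds in `T`, as (b)
    -- requires after transposition.
    obtain ⟨L, hL, hs⟩ := isEssentialSubmodule_moduleSocle_iff.1 ha.2 (LinearMap.range ψ)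
      (fun h => hψ (LinearMap.range_eq_bot.1 h))
    let e := subquotientComapEquiv ψ hL
    refine ⟨LinearMap.ker ψ, L.comap ψ, fun x hx => ?_, IsSimpleModule.congr e, hadj.2
      ⟨L.subtype.comp e.toLinearMap, fun h => ?_⟩⟩
    · rw [Submodule.mem_comap, LinearMap.mem_ker.1 hx]
      exact L.zero_mem
    · obtain ⟨x, hx, hx0⟩ := (Submodule.ne_bot_iff L).1 (isSimpleModule_iff_isAtom.1 hs).1
      apply hx0
      have := LinearMap.congr_fun h (e.symm ⟨x, hx⟩)
      simpa using this
  tfae_have 2 → 3 := by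
    intro hb K hK
    -- `K` is finitely generated because `T` is Noetherian. It is replaced by an isomorphic quotient
    -- of `U^n`, which lies in the universe over which (b) quantifies.
    obtain ⟨n, p, hp⟩ := Module.Finite.exists_fin' (UniversalEnvelopingAlgebra k 𝔤) K
    let e := p.quotKerEquivOfSurjective hp
    let f := K.subtype.comp e.toLinearMap
    have hfinj : Function.Injective f := K.subtype_injective.comp e.injective
    have hf : f ≠ 0 := by
      intro h
      obtain ⟨x, hx, hx0⟩ := (Submodule.ne_bot_iff K).1 hK
      apply hx0
      have := LinearMap.congr_fun h (e.symm ⟨x, hx⟩)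
      simpa [f] using this
    obtain ⟨N₁, N₂, h12, hs, hg⟩ := hb _ (hadj.2 ⟨f, hf⟩)
    obtain ⟨ψ, hψ⟩ := hadj.1 hg
    let e' := subquotientMapEquiv hfinj N₁ N₂
    have hs' := IsSimpleModule.congr e'.symm
    refine ⟨N₁.map f, N₂.map f, Submodule.map_mono h12, ?_, hs', d, hS,
      hS.of_ne_zero_to_utensor (ψ := ψ.comp e'.symm.toLinearMap) fun h => hψ ?_⟩
    · rintro _ ⟨x, -, rfl⟩
      exact (e x).2
    · ext x
      have := LinearMap.congr_fun h (e' (Submodule.Quotient.mk x))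
      simpa using this
  tfae_have 3 → 1 := by
    intro hc
    obtain ⟨C, hC⟩ := hS.exists_growthLE
    refine ⟨isFiniteLength_moduleSocle _ _, isEssentialSubmodule_moduleSocle_iff.2
      (exists_simple_le_of_growth (c := 1 / (2 * d.factorial)) (by positivity)
        (hC.utensor (E := E)) fun K hK => ?_)⟩
    obtain ⟨N₁, N₂, h12, h2, hs, d', hd', hL⟩ := hc K hK
    -- Uniqueness of the dimension makes the lower constant `1 / (2 * d!)` the same for all the
    -- subquotients.
    obtain rfl := hS.unique hd'
    exact ⟨N₁, N₂, h12, h2, hs, hL.growthGE⟩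
  tfae_finish
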